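/- Let $$M=\begin{bmatrix} 0&1&0&0\\ -1&0&0&1\\ 0&0&-1&1\\ 0&0&0&1\end{bmatrix}\in \mathrm{GL}_4(\mathbb Z),\qquad M^4=I,$$ and let $\Gamma=\mathbb Z^4\rtimes \mathbb Z_4$ be the semidirect product (a 4-dimensional crystallographic group) in which $\mathbb Z_4=\mathbb Z/4$ acts on the lattice $\mathbb Z^4$ of row vectors with the generator acting by $v\mapsto vM$ (so the $i$-th standard basis vector is sent to the $i$-th row of $M$). Then the cohomology of $\Gamma$ with coefficients in the trivial module $\mathbb Z$ is, up to isomorphism of abelian groups, - $H^1(\Gamma,\mathbb Z)\cong\mathbb Z$; - $H^2(\Gamma,\mathbb Z)\cong H^3(\Gamma,\mathbb Z)\cong\mathbb Z\oplus\mathbb Z_4\oplus\mathbb Z_2$; - $H^{2k}(\Gamma,\mathbb Z)\cong\mathbb Z_4^2$ for every $k\ge 2$; - $H^{2k+1}(\Gamma,\mathbb Z)\cong\mathbb Z_2^4$ for every $k\ge 2$. -/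

import Mathlib

/-- The integral `4 × 4` matrix `M` that generates the holonomy group. -/
def holonomyMatrix : Matrix (Fin 4) (Fin 4) ℤ :=
  !![ 0, 1,  0, 0;
     -1, 0,  0, 1;
      0, 0, -1, 1;
      0, 0,  0, 1]

theorem holonomyMatrix_pow_four : holonomyMatrix ^ 4 = 1 := by
  decide +kernel

theorem holonomyMatrix_pow_val_add (a b : ZMod 4) :
    holonomyMatrix ^ (a + b).val = holonomyMatrix ^ a.val * holonomyMatrix ^ b.val := by
  rw [ZMod.val_add, ← pow_eq_pow_mod _ holonomyMatrix_pow_four, pow_add]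

/-- The action of the cyclic group of order four on the lattice `ℤ⁴` of row vectors in which the
class of `a` modulo `4` acts by `v ↦ v * M ^ a`. In particular the generator sends the `i`-th
standard basis vector to the `i`-th row of `M`. -/
def holonomyAction : Multiplicative (ZMod 4) →* MulAut (Multiplicative (Fin 4 → ℤ)) where
  toFun g :=
    { toFun := fun v =>
        Multiplicative.ofAdd (Matrix.vecMul v.toAdd (holonomyMatrix ^ g.toAdd.val))
      invFun := fun v =>
        Multiplicative.ofAdd (Matrix.vecMul v.toAdd (holonomyMatrix ^ (-g.toAdd).val))
      left_inv := fun v => by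
        simp [Matrix.vecMul_vecMul, ← holonomyMatrix_pow_val_add]
      right_inv := fun v => by
        simp [Matrix.vecMul_vecMul, ← holonomyMatrix_pow_val_add]
      map_mul' := fun v w => by
        simp [Matrix.add_vecMul] }
  map_one' := by
    ext v : 1
    simp
  map_mul' g h := by
    ext v : 1
    simp [Matrix.vecMul_vecMul, ← holonomyMatrix_pow_val_add, add_comm]

/-- The split crystallographic group `Γ = ℤ⁴ ⋊ ℤ/4`. -/
abbrev CrystalGroup : Type :=
  Multiplicative (Fin 4 → ℤ) ⋊[holonomyAction] Multiplicative (ZMod 4)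

/-- The integral cohomology group `Hⁿ(Γ, ℤ)`, with trivial action of `Γ` on `ℤ`. -/
noncomputable abbrev crystalCohomology (n : ℕ) : ModuleCat ℤ :=
  groupCohomology (Rep.trivial ℤ CrystalGroup ℤ) n

/-! The lattice of `Γ` embeds with index two in a lattice `L = ℤ⁴` by `v ↦ (v₀, v₁, v₂,
v₀+v₁+v₂+2v₃)`, with coordinates `a, b, d, c`. In these coordinates the holonomy is a signed
permutation of the axes, so it preserves the tessellation of `ℝ⁴` by unit cubes. The cellular chains
form the Koszul complex of four commuting translations. The holonomy acts on it by an automorphism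
whose fourth power is exactly the identity (`rotate_four`), so the Koszul complex combines with the
2-periodic resolution of `ℤ/4` into a double complex without correction terms.

Each term of the double complex is a copy of `ℤ[ℤ/4 ⋉ L]`, whose basis elements are the sites. It is
free of rank two over `Γ`, because parity separates exactly two orbits (`smul_rep_bijective`). The
Koszul direction contracts onto the sites over the origin, and there the periodic direction is exact
because the module is induced; together these give `exists_total_eq`. The total complex is thus a
projective resolution of `ℤ`.

An equivariant cochain with values in `ℤ` is a vector of 32 integers, one for each of the 16 cells
and 2 orbits, supported on cells of dimension at most the degree. The coboundary is right
multiplication by an integer matrix whose relevant rows depend only on the parity of the degree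
(`vecMul_orbitMatrix_eq`). Two explicit matrices therefore govern all degrees. In each case a
certificate of matrix identities splits every cocycle into a combination of generators plus a
coboundary and reads off the orders of the generators. Five certificates suffice: one for each of
the degrees one, two and three, and one for each parity from degree four on. -/

/-! ### The double complex of a Koszul complex and a periodic complex -/

/-- The cells of the unit cube in `ℝ⁴`: the flags record which of the coordinate directions
`a`, `b`, `d`, `c` (in this order) the cell spans. -/
abbrev Cell : Type := Bool × Bool × Bool × Bool

/-- The dimension of a cell. -/
def Cell.dim (J : Cell) : ℕ := J.1.toNat + J.2.1.toNat + J.2.2.1.toNat + J.2.2.2.toNat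

theorem Cell.dim_le (J : Cell) : J.dim ≤ 4 := by
  revert J; decide

/-- Four commuting translations `A, B, C, D` of an abelian group together with an automorphism `g`
of order four that acts on them as the signed permutation `A ↦ B⁻¹`, `B ↦ A`, `C ↦ C`,
`D ↦ D⁻¹`. -/
structure LatticeOps (M : Type*) [AddCommGroup M] where
  A : M →+ M
  Ai : M →+ M
  B : M →+ M
  Bi : M →+ M
  C : M →+ M
  D : M →+ M
  Di : M →+ M
  g : M →+ M
  A_Ai : ∀ m, A (Ai m) = m
  Ai_A : ∀ m, Ai (A m) = m
  B_Bi : ∀ m, B (Bi m) = m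
  Bi_B : ∀ m, Bi (B m) = m
  D_Di : ∀ m, D (Di m) = m
  Di_D : ∀ m, Di (D m) = m
  B_A : ∀ m, B (A m) = A (B m)
  B_Ai : ∀ m, B (Ai m) = Ai (B m)
  Bi_A : ∀ m, Bi (A m) = A (Bi m)
  Bi_Ai : ∀ m, Bi (Ai m) = Ai (Bi m)
  C_A : ∀ m, C (A m) = A (C m)
  C_Ai : ∀ m, C (Ai m) = Ai (C m)
  C_B : ∀ m, C (B m) = B (C m)
  C_Bi : ∀ m, C (Bi m) = Bi (C m)
  D_A : ∀ m, D (A m) = A (D m)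
  D_Ai : ∀ m, D (Ai m) = Ai (D m)
  D_B : ∀ m, D (B m) = B (D m)
  D_Bi : ∀ m, D (Bi m) = Bi (D m)
  D_C : ∀ m, D (C m) = C (D m)
  Di_A : ∀ m, Di (A m) = A (Di m)
  Di_Ai : ∀ m, Di (Ai m) = Ai (Di m)
  Di_B : ∀ m, Di (B m) = B (Di m)
  Di_Bi : ∀ m, Di (Bi m) = Bi (Di m)
  Di_C : ∀ m, Di (C m) = C (Di m)
  g_A : ∀ m, g (A m) = Bi (g m)
  g_Ai : ∀ m, g (Ai m) = B (g m)
  g_B : ∀ m, g (B m) = A (g m)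
  g_Bi : ∀ m, g (Bi m) = Ai (g m)
  g_C : ∀ m, g (C m) = C (g m)
  g_D : ∀ m, g (D m) = Di (g m)
  g_Di : ∀ m, g (Di m) = D (g m)
  g_four : ∀ m, g (g (g (g m))) = m

namespace LatticeOps

variable {M : Type*} [AddCommGroup M] (o : LatticeOps M)

attribute [simp] A_Ai Ai_A B_Bi Bi_B D_Di Di_D B_A B_Ai Bi_A Bi_Ai C_A C_Ai C_B C_Bi D_A D_Ai D_B
  D_Bi D_C Di_A Di_Ai Di_B Di_Bi Di_C g_A g_Ai g_B g_Bi g_C g_D g_Di g_four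

/-- Change the sign if the flag is set. -/
def signed (p : Bool) (m : M) : M := if p then -m else m

@[simp] theorem signed_false (m : M) : signed false m = m := rfl

@[simp] theorem signed_true (m : M) : signed true m = -m := rfl

/-- The Koszul differential of `A - 1, B - 1, D - 1, C - 1`. -/
def koszul (x : Cell → M) (J : Cell) : M :=
  (if J.2.2.2 then 0 else
    o.C (x (J.1, J.2.1, J.2.2.1, true)) - x (J.1, J.2.1, J.2.2.1, true)) +
  signed J.2.2.2 (if J.2.2.1 then 0 else
    o.D (x (J.1, J.2.1, true, J.2.2.2)) - x (J.1, J.2.1, true, J.2.2.2)) +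
  signed (xor J.2.2.1 J.2.2.2) (if J.2.1 then 0 else
    o.B (x (J.1, true, J.2.2)) - x (J.1, true, J.2.2)) +
  signed (xor J.2.1 (xor J.2.2.1 J.2.2.2)) (if J.1 then 0 else
    o.A (x (true, J.2)) - x (true, J.2))

/-- The automorphism of the Koszul complex induced by `g`. -/
def rotate (x : Cell → M) : Cell → M
  | (false, false, false, c) => o.g (x (false, false, false, c))
  | (true, false, false, c) => o.g (x (false, true, false, c))
  | (false, true, false, c) => -o.Bi (o.g (x (true, false, false, c)))
  | (true, true, false, c) => o.Bi (o.g (x (true, true, false, c)))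
  | (false, false, true, c) => -o.Di (o.g (x (false, false, true, c)))
  | (true, false, true, c) => -o.Di (o.g (x (false, true, true, c)))
  | (false, true, true, c) => o.Di (o.Bi (o.g (x (true, false, true, c))))
  | (true, true, true, c) => -o.Di (o.Bi (o.g (x (true, true, true, c))))

theorem koszul_add (x y : Cell → M) : o.koszul (x + y) = o.koszul x + o.koszul y := by
  funext ⟨a, b, d, c⟩
  cases a <;> cases b <;> cases d <;> cases c <;> simp [koszul] <;> abel

theorem rotate_add (x y : Cell → M) : o.rotate (x + y) = o.rotate x + o.rotate y := by
  funext ⟨a, b, d, c⟩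
  cases a <;> cases b <;> cases d <;> simp [rotate] <;> abel

/-- `koszul` as an additive map. -/
def koszulHom : (Cell → M) →+ (Cell → M) := AddMonoidHom.mk' o.koszul o.koszul_add

/-- `rotate` as an additive map. -/
def rotateHom : (Cell → M) →+ (Cell → M) := AddMonoidHom.mk' o.rotate o.rotate_add

theorem koszul_koszul (x : Cell → M) : o.koszul (o.koszul x) = 0 := by
  funext ⟨a, b, d, c⟩
  cases a <;> cases b <;> cases d <;> cases c <;> simp [koszul] <;> abel

/-- Rests on `g(A - 1) = -B⁻¹(B - 1)g`, `g(B - 1) = (A - 1)g` and `g(D - 1) = -D⁻¹(D - 1)g`.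
Reversing an edge produces the sign and the shift by `B⁻¹` or `D⁻¹` in `rotate`. -/
theorem koszul_rotate (x : Cell → M) : o.koszul (o.rotate x) = o.rotate (o.koszul x) := by
  funext ⟨a, b, d, c⟩
  cases a <;> cases b <;> cases d <;> cases c <;> simp [koszul, rotate] <;> abel

/-- The signs and shifts cancel on the nose, so no higher homotopies are needed in the total
differential. -/
theorem rotate_four (x : Cell → M) : o.rotate (o.rotate (o.rotate (o.rotate x))) = x := by
  funext ⟨a, b, d, c⟩
  cases a <;> cases b <;> cases d <;> simp [rotate]

/-- The differentials of the periodic complex of the cyclic group of order four, truncated in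
degree zero. -/
def periodic (p : ℕ) (x : Cell → M) : Cell → M :=
  if p = 0 then 0 else if p % 2 = 1 then o.rotate x - x
  else x + o.rotate x + o.rotate (o.rotate x) + o.rotate (o.rotate (o.rotate x))

theorem periodic_add (p : ℕ) (x y : Cell → M) :
    o.periodic p (x + y) = o.periodic p x + o.periodic p y := by
  unfold periodic
  split_ifs
  · simp
  · rw [rotate_add]; abel
  · simp only [rotate_add]; abel

/-- The total differential in degree `n`. -/
def total (n : ℕ) (x : Cell → M) : Cell → M := fun J =>
  o.koszul x J + (-1 : ℤ) ^ J.dim • o.periodic (n - J.dim) x J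

theorem total_add (n : ℕ) (x y : Cell → M) : o.total n (x + y) = o.total n x + o.total n y := by
  funext J
  simp only [total, koszul_add, periodic_add, Pi.add_apply, smul_add]
  abel

/-- `total` as an additive map. -/
def totalHom (n : ℕ) : (Cell → M) →+ (Cell → M) := AddMonoidHom.mk' (o.total n) (o.total_add n)

end LatticeOps

namespace LatticeOps

variable {M : Type*} [AddCommGroup M] (o : LatticeOps M)

/-- The sign and the periodic degree in `total` vary with the dimension of the cell. Locality allows
them to be frozen at the one dimension that matters. -/
theorem koszul_congr {x y : Cell → M} {J : Cell}
    (h : ∀ K : Cell, K.dim = J.dim + 1 → x K = y K) : o.koszul x J = o.koszul y J := by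
  obtain ⟨a, b, d, c⟩ := J
  cases a <;> cases b <;> cases d <;> cases c <;> simp [koszul, Cell.dim] at h ⊢ <;> simp [h]

theorem rotate_congr {x y : Cell → M} {J : Cell}
    (h : ∀ K : Cell, K.dim = J.dim → x K = y K) : o.rotate x J = o.rotate y J := by
  obtain ⟨a, b, d, c⟩ := J
  cases a <;> cases b <;> cases d <;> cases c <;> simp [rotate, Cell.dim] at h ⊢ <;> simp [h]

theorem periodic_congr {p : ℕ} {x y : Cell → M} {J : Cell}
    (h : ∀ K : Cell, K.dim = J.dim → x K = y K) : o.periodic p x J = o.periodic p y J := by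
  have h1 : ∀ K : Cell, K.dim = J.dim → o.rotate x K = o.rotate y K := fun K hK =>
    o.rotate_congr fun L hL => h L (hL.trans hK)
  have h2 : ∀ K : Cell, K.dim = J.dim → o.rotate (o.rotate x) K = o.rotate (o.rotate y) K :=
    fun K hK => o.rotate_congr fun L hL => h1 L (hL.trans hK)
  unfold periodic
  split_ifs
  · rfl
  · simp [h J rfl, h1 J rfl]
  · simp [h J rfl, h1 J rfl, h2 J rfl, o.rotate_congr h2]

theorem rotate_sub (x y : Cell → M) : o.rotate (x - y) = o.rotate x - o.rotate y :=
  map_sub o.rotateHom x y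

theorem koszul_sub (x y : Cell → M) : o.koszul (x - y) = o.koszul x - o.koszul y :=
  map_sub o.koszulHom x y

theorem koszul_zero : o.koszul (0 : Cell → M) = 0 := map_zero o.koszulHom

theorem koszul_zsmul (k : ℤ) (x : Cell → M) : o.koszul (k • x) = k • o.koszul x :=
  map_zsmul o.koszulHom k x

/-- `periodic` as an additive map. -/
def periodicHom (p : ℕ) : (Cell → M) →+ (Cell → M) :=
  AddMonoidHom.mk' (o.periodic p) (o.periodic_add p)

theorem periodic_zsmul (p : ℕ) (k : ℤ) (x : Cell → M) :
    o.periodic p (k • x) = k • o.periodic p x :=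
  map_zsmul (o.periodicHom p) k x

theorem periodic_zero (p : ℕ) : o.periodic p (0 : Cell → M) = 0 := map_zero (o.periodicHom p)

theorem total_sub (n : ℕ) (x y : Cell → M) : o.total n (x - y) = o.total n x - o.total n y :=
  map_sub (o.totalHom n) x y

theorem koszul_periodic (p : ℕ) (x : Cell → M) :
    o.koszul (o.periodic p x) = o.periodic p (o.koszul x) := by
  unfold periodic
  split_ifs
  · exact o.koszul_zero
  · rw [koszul_sub, koszul_rotate]
  · simp only [koszul_add, koszul_rotate]

theorem periodic_periodic (p : ℕ) (x : Cell → M) :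
    o.periodic p (o.periodic (p + 1) x) = 0 := by
  rcases Nat.eq_zero_or_pos p with rfl | hp
  · simp [periodic]
  rcases Nat.mod_two_eq_zero_or_one p with h | h
  · have h1 : (p + 1) % 2 = 1 := by omega
    simp [periodic, h, h1, hp.ne', rotate_sub, rotate_four]
  · have h1 : (p + 1) % 2 = 0 := by omega
    simp only [periodic, h, h1, hp.ne', if_true, if_false, rotate_add, rotate_four,
      Nat.succ_ne_zero, zero_ne_one]
    abel

/-- The Koszul and periodic differentials commute, and the sign `(-1) ^ J.dim` changes by one step
along `koszul`, so the mixed terms cancel. -/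
theorem total_total (n : ℕ) (x : Cell → M) : o.total n (o.total (n + 1) x) = 0 := by
  funext J
  have h1 : o.koszul (o.total (n + 1) x) J =
      (-1 : ℤ) ^ (J.dim + 1) • o.periodic (n - J.dim) (o.koszul x) J := by
    have : o.koszul (o.total (n + 1) x) J =
        o.koszul (o.koszul x + (-1 : ℤ) ^ (J.dim + 1) • o.periodic (n - J.dim) x) J :=
      o.koszul_congr fun K hK => by simp [total, hK]
    rw [this, koszul_add, koszul_koszul, koszul_zsmul, koszul_periodic]
    simp
  have h2 : o.periodic (n - J.dim) (o.total (n + 1) x) J =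
      o.periodic (n - J.dim) (o.koszul x) J := by
    have : o.periodic (n - J.dim) (o.total (n + 1) x) J =
        o.periodic (n - J.dim)
          (o.koszul x + (-1 : ℤ) ^ J.dim • o.periodic (n + 1 - J.dim) x) J :=
      o.periodic_congr fun K hK => by simp [total, hK]
    rw [this, periodic_add, periodic_zsmul]
    -- Above dimension `n` the truncated subtraction gives periodic degree zero, where the
    -- differential is zero by convention.
    rcases le_or_gt J.dim n with h | h
    · rw [Nat.sub_add_comm h, periodic_periodic]; simp
    · rw [Nat.sub_eq_zero_of_le h.le]; simp [periodic]
  simp only [total] at h1 h2 ⊢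
  rw [h1, h2]
  simp [pow_succ]

/-- A total differential maps chains supported in dimension at most `n + 1` to chains supported in
dimension at most `n`. -/
theorem total_eq_zero_of_lt {n : ℕ} {x : Cell → M} (hx : ∀ J : Cell, n + 1 < J.dim → x J = 0)
    {J : Cell} (hJ : n < J.dim) : o.total (n + 1) x J = 0 := by
  have h1 : o.koszul x J = o.koszul 0 J :=
    o.koszul_congr fun K hK => hx K (by omega)
  simp [total, h1, koszul_zero, Nat.sub_eq_zero_of_le hJ, periodic]

end LatticeOps

/-! ### Exactness of the total complex from contractions -/

/-- Contracting homotopies `kₓ` of the four two-term complexes given by the translations of `o`,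
and a projection `r` onto a fundamental domain for the action of `g`. -/
structure LatticeContraction {M : Type*} [AddCommGroup M] (o : LatticeOps M) where
  ka : M →+ M
  kb : M →+ M
  kc : M →+ M
  kd : M →+ M
  pa : M →+ M
  pb : M →+ M
  pc : M →+ M
  pd : M →+ M
  r : M →+ M
  A_ka : ∀ m, o.A (ka m) = ka m + m - pa m
  B_kb : ∀ m, o.B (kb m) = kb m + m - pb m
  C_kc : ∀ m, o.C (kc m) = kc m + m - pc m
  D_kd : ∀ m, o.D (kd m) = kd m + m - pd m
  ka_A : ∀ m, ka (o.A m) = ka m + m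
  kb_B : ∀ m, kb (o.B m) = kb m + m
  kc_C : ∀ m, kc (o.C m) = kc m + m
  kd_D : ∀ m, kd (o.D m) = kd m + m
  pa_A : ∀ m, pa (o.A m) = pa m
  pb_B : ∀ m, pb (o.B m) = pb m
  pc_C : ∀ m, pc (o.C m) = pc m
  pd_D : ∀ m, pd (o.D m) = pd m
  ka_B : ∀ m, ka (o.B m) = o.B (ka m)
  ka_C : ∀ m, ka (o.C m) = o.C (ka m)
  ka_D : ∀ m, ka (o.D m) = o.D (ka m)
  kb_A : ∀ m, kb (o.A m) = o.A (kb m)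
  kb_C : ∀ m, kb (o.C m) = o.C (kb m)
  kb_D : ∀ m, kb (o.D m) = o.D (kb m)
  kc_A : ∀ m, kc (o.A m) = o.A (kc m)
  kc_B : ∀ m, kc (o.B m) = o.B (kc m)
  kc_D : ∀ m, kc (o.D m) = o.D (kc m)
  kd_A : ∀ m, kd (o.A m) = o.A (kd m)
  kd_B : ∀ m, kd (o.B m) = o.B (kd m)
  kd_C : ∀ m, kd (o.C m) = o.C (kd m)
  pa_B : ∀ m, pa (o.B m) = o.B (pa m)
  pa_C : ∀ m, pa (o.C m) = o.C (pa m)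
  pa_D : ∀ m, pa (o.D m) = o.D (pa m)
  pb_A : ∀ m, pb (o.A m) = o.A (pb m)
  pb_C : ∀ m, pb (o.C m) = o.C (pb m)
  pb_D : ∀ m, pb (o.D m) = o.D (pb m)
  pc_A : ∀ m, pc (o.A m) = o.A (pc m)
  pc_B : ∀ m, pc (o.B m) = o.B (pc m)
  pc_D : ∀ m, pc (o.D m) = o.D (pc m)
  pd_A : ∀ m, pd (o.A m) = o.A (pd m)
  pd_B : ∀ m, pd (o.B m) = o.B (pd m)
  pd_C : ∀ m, pd (o.C m) = o.C (pd m)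
  p_g : ∀ m, pc (pd (pb (pa (o.g m)))) = o.g (pc (pd (pb (pa m))))
  p_p : ∀ m, pc (pd (pb (pa (pc (pd (pb (pa m))))))) = pc (pd (pb (pa m)))
  g_r : ∀ m, r m + o.g (r (o.g (o.g (o.g m)))) + o.g (o.g (r (o.g (o.g m)))) +
    o.g (o.g (o.g (r (o.g m)))) = m

namespace LatticeContraction

variable {M : Type*} [AddCommGroup M] {o : LatticeOps M} (c : LatticeContraction o)

attribute [simp] A_ka B_kb C_kc D_kd ka_A kb_B kc_C kd_D pa_A pb_B pc_C pd_D ka_B ka_C ka_D kb_A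
  kb_C kb_D kc_A kc_B kc_D kd_A kd_B kd_C pa_B pa_C pa_D pb_A pb_C pb_D pc_A pc_B pc_D pd_A pd_B
  pd_C p_g p_p

/-- The contracting homotopy of the Koszul complex. -/
def homotopy (x : Cell → M) : Cell → M
  | (a, b, d, true) => c.kc (x (a, b, d, false))
  | (a, b, true, false) => c.pc (c.kd (x (a, b, false, false)))
  | (a, true, false, false) => c.pc (c.pd (c.kb (x (a, false, false, false))))
  | (true, false, false, false) => c.pc (c.pd (c.pb (c.ka (x (false, false, false, false)))))
  | (false, false, false, false) => 0

/-- The projection of the chains of dimension zero onto the chains over the origin. -/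
def origin (m : M) : M := c.pc (c.pd (c.pb (c.pa m)))

/-- The simp set moves translations outwards past the projections, where `D_kd` no longer applies;
here the commutation is used backwards. The next two lemmas serve the same purpose. -/
theorem D_pc_kd (m : M) : o.D (c.pc (c.kd m)) = c.pc (c.kd m) + c.pc m - c.pc (c.pd m) := by
  rw [← pc_D, D_kd, map_sub, map_add]

theorem B_pc_pd_kb (m : M) : o.B (c.pc (c.pd (c.kb m))) =
    c.pc (c.pd (c.kb m)) + c.pc (c.pd m) - c.pc (c.pd (c.pb m)) := by
  rw [← pc_B, ← pd_B, B_kb]; simp only [map_sub, map_add]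

theorem A_pc_pd_pb_ka (m : M) : o.A (c.pc (c.pd (c.pb (c.ka m)))) =
    c.pc (c.pd (c.pb (c.ka m))) + c.pc (c.pd (c.pb m)) - c.pc (c.pd (c.pb (c.pa m))) := by
  rw [← pc_A, ← pd_A, ← pb_A, A_ka]; simp only [map_sub, map_add]

/-- The usual homotopy for a tensor product of contractions. In the order `c, d, b, a`, the
identities for the axes telescope: `(1 - pc) + pc(1 - pd) + pc pd(1 - pb) + pc pd pb(1 - pa)`. -/
theorem koszul_homotopy (x : Cell → M) (J : Cell) :
    o.koszul (c.homotopy x) J + c.homotopy (o.koszul x) J =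
      x J - (if J = (false, false, false, false) then
        c.origin (x (false, false, false, false)) else 0) := by
  obtain ⟨i, j, k, l⟩ := J
  cases i <;> cases j <;> cases k <;> cases l <;>
    simp [LatticeOps.koszul, homotopy, origin, D_pc_kd, B_pc_pd_kb, A_pc_pd_pb_ka] <;> abel

end LatticeContraction

namespace LatticeOps

variable {M : Type*} [AddCommGroup M] (o : LatticeOps M)

/-- The norm of the action of `g`. -/
def norm (m : M) : M := m + o.g m + o.g (o.g m) + o.g (o.g (o.g m))

theorem periodic_vertex (p : ℕ) (x : Cell → M) :
    o.periodic p x (false, false, false, false) =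
      if p = 0 then 0 else if p % 2 = 1 then
        o.g (x (false, false, false, false)) - x (false, false, false, false)
      else o.norm (x (false, false, false, false)) := by
  unfold periodic norm
  split_ifs <;> simp [rotate]

theorem total_zero_eq_zero {x : Cell → M} (hx : ∀ J : Cell, 0 < J.dim → x J = 0) :
    o.total 0 x = 0 := by
  funext J
  have h1 : o.koszul x J = o.koszul 0 J :=
    o.koszul_congr fun K hK => hx K (by omega)
  simp [total, h1, koszul_zero, periodic]

end LatticeOps

namespace LatticeContraction

variable {M : Type*} [AddCommGroup M] {o : LatticeOps M} (c : LatticeContraction o)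

/-- For invariant `m` the decomposition `g_r` reads `norm (r m) = m`. -/
theorem exists_norm_eq (c : LatticeContraction o) {m : M} (h : o.g m = m) : ∃ w, o.norm w = m :=
  ⟨c.r m, by simpa [LatticeOps.norm, h] using c.g_r m⟩

theorem exists_sub_eq (c : LatticeContraction o) {m : M} (h : o.norm m = 0) : ∃ w, o.g w - w = m := by
  have h1 := congrArg c.r h
  have h2 := c.g_r m
  simp only [LatticeOps.norm, map_add, map_zero] at h1
  -- Put `rᵢ = r(gⁱm)`. Subtracting `r₀ + r₁ + r₂ + r₃ = 0` from `m = r₀ + g r₃ + g² r₂ + g³ r₁`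
  -- leaves `(g-1)r₃ + (g²-1)r₂ + (g³-1)r₁`; dividing by `g - 1` gives the witness.
  refine ⟨c.r (o.g (o.g (o.g m))) + c.r (o.g (o.g m)) + o.g (c.r (o.g (o.g m))) +
    c.r (o.g m) + o.g (c.r (o.g m)) + o.g (o.g (c.r (o.g m))), ?_⟩
  simp only [map_add]
  refine Eq.trans ?_ ((congrArg₂ (· - ·) h2 h1).trans (sub_zero m))
  abel

theorem homotopy_eq_zero {x : Cell → M} {J : Cell}
    (h : ∀ K : Cell, K.dim + 1 = J.dim → x K = 0) : c.homotopy x J = 0 := by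
  obtain ⟨i, j, k, l⟩ := J
  cases i <;> cases j <;> cases k <;> cases l <;> simp [homotopy, Cell.dim] at h ⊢ <;> simp [h]

/-- If a cycle vanishes below dimension `j`, its periodic terms vanish there too, so `koszul x` is
zero below `j`. The Koszul homotopy then removes the components in dimension `j`. -/
theorem exists_total_step {n j : ℕ} {x : Cell → M} (hx : ∀ J : Cell, n < J.dim → x J = 0)
    (hj : ∀ J : Cell, J.dim < j → x J = 0) (h : o.total n x = 0)
    (h0 : c.origin (x (false, false, false, false)) = 0) :
    ∃ y : Cell → M, (∀ J : Cell, n + 1 < J.dim → y J = 0) ∧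
      ∀ J : Cell, J.dim < j + 1 → (x - o.total (n + 1) y) J = 0 := by
  refine ⟨c.homotopy x, fun J hJ => c.homotopy_eq_zero fun K hK => hx K (by omega),
    fun J hJ => ?_⟩
  have hH : ∀ K : Cell, K.dim = J.dim → c.homotopy x K = (0 : Cell → M) K := fun K hK =>
    c.homotopy_eq_zero fun L hL => hj L (by omega)
  have h1 : c.homotopy (o.koszul x) J = 0 := c.homotopy_eq_zero fun K hK => by
    have h2 := congrFun h K
    have h3 : o.periodic (n - K.dim) x K = o.periodic (n - K.dim) 0 K :=
      o.periodic_congr fun L hL => hj L (by omega)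
    simpa [LatticeOps.total, h3, o.periodic_zero] using h2
  have h4 := c.koszul_homotopy x J
  rw [h1, h0, add_zero, ite_self, sub_zero] at h4
  simp [LatticeOps.total, h4, o.periodic_congr hH, o.periodic_zero]

theorem exists_total_of_origin {n : ℕ} (j : ℕ) {x : Cell → M}
    (hx : ∀ J : Cell, n < J.dim → x J = 0) (h : o.total n x = 0)
    (h0 : c.origin (x (false, false, false, false)) = 0) :
    ∃ y : Cell → M, (∀ J : Cell, n + 1 < J.dim → y J = 0) ∧
      ∀ J : Cell, J.dim < j + 1 → (x - o.total (n + 1) y) J = 0 := by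
  induction j with
  | zero => exact c.exists_total_step hx (by simp) h h0
  | succ j ih =>
    obtain ⟨y, hy, hy'⟩ := ih
    obtain ⟨z, hz, hz'⟩ := c.exists_total_step (n := n) (x := x - o.total (n + 1) y)
      (fun J hJ => by simp [hx J hJ, o.total_eq_zero_of_lt hy hJ]) hy'
      (by rw [o.total_sub, h, o.total_total, sub_zero])
      -- After the first step the vertex component is zero, so the condition on the origin persists.
      (by rw [hy' _ (by simp [Cell.dim])]; simp [origin])
    refine ⟨y + z, fun J hJ => by simp [hy J hJ, hz J hJ], fun J hJ => ?_⟩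
    rw [o.total_add, ← sub_sub]
    exact hz' J hJ

theorem origin_koszul (x : Cell → M) :
    c.origin (o.koszul x (false, false, false, false)) = 0 := by
  simp [LatticeOps.koszul, origin]

theorem origin_g (m : M) : c.origin (o.g m) = o.g (c.origin m) := c.p_g m

theorem origin_norm (m : M) : c.origin (o.norm m) = o.norm (c.origin m) := by
  simp only [LatticeOps.norm, ← origin_g]
  simp [origin]

/-- Since `origin` kills Koszul boundaries and commutes with `g`, it maps the total complex to the
periodic complex of `M`. -/
theorem norm_origin_of_total {n : ℕ} {x : Cell → M} (h : o.total n x = 0) :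
    (if n = 0 then 0 else if n % 2 = 1 then
      o.g (c.origin (x (false, false, false, false))) - c.origin (x (false, false, false, false))
      else o.norm (c.origin (x (false, false, false, false)))) = 0 := by
  have h1 := congrArg c.origin (congrFun h (false, false, false, false))
  have h2 : ∀ m m' : M, c.origin (m + m') = c.origin m + c.origin m' := by simp [origin]
  have h3 : c.origin 0 = 0 := by simp [origin]
  have h4 : ∀ m m' : M, c.origin (m - m') = c.origin m - c.origin m' := by simp [origin]
  simp only [LatticeOps.total, h2, origin_koszul, Cell.dim, Bool.toNat_false, add_zero, pow_zero,
    one_smul, Nat.sub_zero, zero_add, o.periodic_vertex, Pi.zero_apply, h3] at h1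
  rw [← h1]
  split_ifs
  · rfl
  · rw [h4, origin_g]
  · rw [origin_norm]

/-- Exactness of the total complex. In degree zero the vanishing of the differential is replaced
by the vanishing of the norm of the projection to the chains over the origin. -/
theorem exists_total_eq {n : ℕ} {x : Cell → M} (hx : ∀ J : Cell, n < J.dim → x J = 0)
    (h : o.total n x = 0)
    (h0 : n = 0 → o.norm (c.origin (x (false, false, false, false))) = 0) :
    ∃ y : Cell → M, (∀ J : Cell, n + 1 < J.dim → y J = 0) ∧ o.total (n + 1) y = x := by
  set z := c.origin (x (false, false, false, false)) with hz
  -- The projected vertex component is a cycle of the periodic complex, hence a boundary.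
  -- Subtracting the boundary of `w`, placed on the vertex, makes this projection vanish.
  obtain ⟨w, hw⟩ : ∃ w, (if (n + 1) % 2 = 1 then o.g w - w else o.norm w) = z := by
    have h1 := c.norm_origin_of_total h
    rcases Nat.mod_two_eq_zero_or_one n with hn | hn
    · have hn' : (n + 1) % 2 = 1 := by omega
      simp only [hn', if_true]
      refine c.exists_sub_eq ?_
      rcases Nat.eq_zero_or_pos n with h2 | h2
      · exact h0 h2
      · simpa [hn, h2.ne'] using h1
    · have hn' : ¬ (n + 1) % 2 = 1 := by omega
      have hn'' : n ≠ 0 := by rintro rfl; simp at hn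
      simp only [hn', if_false]
      exact c.exists_norm_eq (sub_eq_zero.1 (by simpa [hn, hn''] using h1))
  let y : Cell → M := Pi.single (false, false, false, false) w
  have hy : ∀ J : Cell, 0 < J.dim → y J = 0 := fun J hJ =>
    Pi.single_eq_of_ne (by rintro rfl; simp [Cell.dim] at hJ) _
  have hy0 : o.total (n + 1) y (false, false, false, false) =
      c.origin (x (false, false, false, false)) := by
    have h1 : o.koszul y (false, false, false, false) = o.koszul 0 (false, false, false, false) :=
      o.koszul_congr fun K hK => hy K (by omega)
    simp only [LatticeOps.total, h1, o.koszul_zero, Cell.dim, o.periodic_vertex]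
    simpa [y] using hw
  -- Four is the top dimension, so the conclusion covers every cell.
  obtain ⟨v, hv, hv'⟩ := c.exists_total_of_origin 4 (n := n) (x := x - o.total (n + 1) y)
    (fun J hJ => by simp [hx J hJ, o.total_eq_zero_of_lt (fun K hK => hy K (by omega)) hJ])
    (by rw [o.total_sub, h, o.total_total, sub_zero])
    (by rw [Pi.sub_apply, hy0]; simp [origin])
  refine ⟨y + v, fun J hJ => by simp [hy J (by omega), hv J hJ], ?_⟩
  rw [o.total_add, eq_comm, ← sub_eq_zero, ← sub_sub]
  funext J
  exact hv' J (Nat.lt_succ_of_le J.dim_le)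

end LatticeContraction

/-! ### Chains of sites and their contraction -/

/-- An element of `ℤ/4 ⋉ ℤ⁴`, with coordinates `a, b, c, d` on the lattice `ℤ⁴` that contains the
translation lattice of `CrystalGroup` with index two. -/
@[ext]
structure Site where
  k : ZMod 4
  a : ℤ
  b : ℤ
  c : ℤ
  d : ℤ

namespace Site

/-- The additive map on chains induced by a map of sites. -/
noncomputable def push (f : Site → Site) : (Site →₀ ℤ) →+ (Site →₀ ℤ) :=
  Finsupp.mapDomain.addMonoidHom f

@[simp] theorem push_single (f : Site → Site) (x : Site) (n : ℤ) :
    push f (Finsupp.single x n) = Finsupp.single (f x) n := Finsupp.mapDomain_single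

theorem push_push (f h : Site → Site) (m : Site →₀ ℤ) : push f (push h m) = push (f ∘ h) m :=
  (Finsupp.mapDomain_comp).symm

theorem push_eq_self {f : Site → Site} (hf : ∀ x, f x = x) (m : Site →₀ ℤ) : push f m = m := by
  have : f = id := funext hf
  rw [this]; exact Finsupp.mapDomain_id

theorem push_comm {f h f' h' : Site → Site} (hf : ∀ x, f (h x) = f' (h' x)) (m : Site →₀ ℤ) :
    push f (push h m) = push f' (push h' m) := by
  rw [push_push, push_push]; exact congrArg (push · m) (funext hf)

theorem addHom_ext {N : Type*} [AddCommGroup N] {f h : (Site →₀ ℤ) →+ N}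
    (H : ∀ x, f (Finsupp.single x 1) = h (Finsupp.single x 1)) (m : Site →₀ ℤ) : f m = h m := by
  refine DFunLike.congr_fun (Finsupp.addHom_ext' fun x => ?_) m
  ext
  exact H x

/-- Right multiplication by the generator of `ℤ/4`. -/
def turn (x : Site) : Site := ⟨x.k + 1, x.b, -x.a, x.c, -x.d⟩

theorem turn_four (x : Site) : turn (turn (turn (turn x))) = x := by
  ext <;> simp [turn]
  generalize x.k = k
  revert k; decide

/-- The translations and the rotation acting on chains of sites. -/
noncomputable def ops : LatticeOps (Site →₀ ℤ) where
  A := push fun x => { x with a := x.a + 1 }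
  Ai := push fun x => { x with a := x.a - 1 }
  B := push fun x => { x with b := x.b + 1 }
  Bi := push fun x => { x with b := x.b - 1 }
  C := push fun x => { x with c := x.c + 1 }
  D := push fun x => { x with d := x.d + 1 }
  Di := push fun x => { x with d := x.d - 1 }
  g := push turn
  A_Ai m := by rw [push_push]; exact push_eq_self (fun x => by ext <;> simp) m
  Ai_A m := by rw [push_push]; exact push_eq_self (fun x => by ext <;> simp) m
  B_Bi m := by rw [push_push]; exact push_eq_self (fun x => by ext <;> simp) m
  Bi_B m := by rw [push_push]; exact push_eq_self (fun x => by ext <;> simp) m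
  D_Di m := by rw [push_push]; exact push_eq_self (fun x => by ext <;> simp) m
  Di_D m := by rw [push_push]; exact push_eq_self (fun x => by ext <;> simp) m
  B_A := push_comm fun _ => rfl
  B_Ai := push_comm fun _ => rfl
  Bi_A := push_comm fun _ => rfl
  Bi_Ai := push_comm fun _ => rfl
  C_A := push_comm fun _ => rfl
  C_Ai := push_comm fun _ => rfl
  C_B := push_comm fun _ => rfl
  C_Bi := push_comm fun _ => rfl
  D_A := push_comm fun _ => rfl
  D_Ai := push_comm fun _ => rfl
  D_B := push_comm fun _ => rfl
  D_Bi := push_comm fun _ => rfl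
  D_C := push_comm fun _ => rfl
  Di_A := push_comm fun _ => rfl
  Di_Ai := push_comm fun _ => rfl
  Di_B := push_comm fun _ => rfl
  Di_Bi := push_comm fun _ => rfl
  Di_C := push_comm fun _ => rfl
  g_A := push_comm fun x => by ext <;> simp [turn]; ring
  g_Ai := push_comm fun x => by ext <;> simp [turn]; ring
  g_B := push_comm fun x => by ext <;> simp [turn]
  g_Bi := push_comm fun x => by ext <;> simp [turn]
  g_C := push_comm fun x => by ext <;> simp [turn]
  g_D := push_comm fun x => by ext <;> simp [turn]; ring
  g_Di := push_comm fun x => by ext <;> simp [turn]; ring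
  g_four m := by
    rw [push_push, push_push, push_push]
    exact push_eq_self turn_four m

/-- The signed interval from `0` to `n`. -/
noncomputable def interval (n : ℤ) : ℤ →₀ ℤ :=
  ∑ i ∈ Finset.Ico 0 n, Finsupp.single i 1 - ∑ i ∈ Finset.Ico n 0, Finsupp.single i 1

theorem interval_succ (n : ℤ) : interval (n + 1) = interval n + Finsupp.single n 1 := by
  rcases le_or_gt 0 n with h | h
  · have h1 : Finset.Ico 0 (n + 1) = insert n (Finset.Ico 0 n) := by ext i; simp; omega
    have h2 : Finset.Ico (n + 1) 0 = ∅ := by simp; omega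
    have h3 : Finset.Ico n 0 = ∅ := by simp; omega
    rw [interval, interval, h1, h2, h3, Finset.sum_insert (by simp)]
    simp [add_comm]
  · have h1 : Finset.Ico n 0 = insert n (Finset.Ico (n + 1) 0) := by ext i; simp; omega
    have h2 : Finset.Ico 0 n = ∅ := by simp; omega
    have h3 : Finset.Ico 0 (n + 1) = ∅ := by simp; omega
    rw [interval, interval, h1, h2, h3, Finset.sum_insert (by simp)]
    simp

theorem mapDomain_add_one_interval (n : ℤ) :
    Finsupp.mapDomain (· + 1) (interval n) =
      interval n + Finsupp.single n 1 - Finsupp.single 0 1 := by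
  -- The defect of the claimed identity does not depend on `n`, so induction in both directions
  -- reduces to `n = 0`.
  have key : ∀ n : ℤ, Finsupp.mapDomain (· + 1) (interval n) -
      (interval n + Finsupp.single n 1 - Finsupp.single 0 1) =
      Finsupp.mapDomain (· + 1) (interval (n + 1)) -
      (interval (n + 1) + Finsupp.single (n + 1) 1 - Finsupp.single 0 1) := fun n => by
    rw [interval_succ, Finsupp.mapDomain_add, Finsupp.mapDomain_single]; abel
  rw [← sub_eq_zero]
  induction n using Int.induction_on with
  | zero => simp [interval]
  | succ i hi => rw [← key]; exact hi
  | pred i hi => rw [key]; simpa using hi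

/-- The contracting homotopy in the direction of the coordinate `t`, where `put x i` is the site
obtained from `x` by changing this coordinate to `i`. -/
noncomputable def axisHomotopy (t : Site → ℤ) (put : Site → ℤ → Site) :
    (Site →₀ ℤ) →+ (Site →₀ ℤ) :=
  Finsupp.liftAddHom fun x =>
    zmultiplesHom (Site →₀ ℤ) (Finsupp.mapDomain (put x) (interval (t x)))

section axis

variable {t : Site → ℤ} {put : Site → ℤ → Site}

@[simp] theorem axisHomotopy_single (x : Site) :
    axisHomotopy t put (Finsupp.single x 1) = Finsupp.mapDomain (put x) (interval (t x)) := by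
  simp [axisHomotopy]

theorem axisHomotopy_push_comm {f : Site → Site} (h1 : ∀ x, t (f x) = t x)
    (h2 : ∀ x i, put (f x) i = f (put x i)) (m : Site →₀ ℤ) :
    axisHomotopy t put (push f m) = push f (axisHomotopy t put m) := by
  refine addHom_ext (f := (axisHomotopy t put).comp (push f))
    (h := (push f).comp (axisHomotopy t put)) (fun x => ?_) m
  simp only [AddMonoidHom.comp_apply, push_single, axisHomotopy_single, h1]
  refine Eq.trans ?_ Finsupp.mapDomain_comp
  congr 1
  funext i
  exact h2 x i

theorem axisHomotopy_push_shift {f : Site → Site} (h1 : ∀ x, t (f x) = t x + 1)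
    (h2 : ∀ x i, put (f x) i = put x i) (h3 : ∀ x, put x (t x) = x) (m : Site →₀ ℤ) :
    axisHomotopy t put (push f m) = axisHomotopy t put m + m := by
  refine addHom_ext (f := (axisHomotopy t put).comp (push f))
    (h := axisHomotopy t put + AddMonoidHom.id _) (fun x => ?_) m
  have : put (f x) = put x := funext (h2 x)
  simp only [AddMonoidHom.comp_apply, push_single, axisHomotopy_single, h1, interval_succ, this,
    Finsupp.mapDomain_add, Finsupp.mapDomain_single, h3]
  simp

/-- Shifting the interval from `0` to `t x` adds its far end `x` and drops its near end `put x 0`.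
-/
theorem push_shift_axisHomotopy {f : Site → Site} (h2 : ∀ x i, f (put x i) = put x (i + 1))
    (h3 : ∀ x, put x (t x) = x) (m : Site →₀ ℤ) :
    push f (axisHomotopy t put m) = axisHomotopy t put m + m - push (fun x => put x 0) m := by
  refine addHom_ext (f := (push f).comp (axisHomotopy t put))
    (h := axisHomotopy t put + AddMonoidHom.id _ - push (fun x => put x 0)) (fun x => ?_) m
  have h4 : push f (Finsupp.mapDomain (put x) (interval (t x))) =
      Finsupp.mapDomain (put x) (Finsupp.mapDomain (· + 1) (interval (t x))) := by
    refine Eq.trans Finsupp.mapDomain_comp.symm (Eq.trans ?_ Finsupp.mapDomain_comp)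
    congr 1
    funext i
    exact h2 x i
  simp only [AddMonoidHom.comp_apply, axisHomotopy_single, h4, mapDomain_add_one_interval,
    AddMonoidHom.sub_apply, AddMonoidHom.add_apply, AddMonoidHom.id_apply, push_single]
  rw [sub_eq_add_neg, Finsupp.mapDomain_add, Finsupp.mapDomain_add, Finsupp.mapDomain_single, h3,
    ← Finsupp.single_neg, Finsupp.mapDomain_single, Finsupp.single_neg, ← sub_eq_add_neg]

end axis

/-- The restriction of a chain to the sites with `k = 0`. -/
noncomputable def base : (Site →₀ ℤ) →+ (Site →₀ ℤ) := Finsupp.filterAddHom fun x => x.k = 0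

theorem base_single (x : Site) : base (Finsupp.single x 1) =
    if x.k = 0 then Finsupp.single x 1 else 0 := by
  split_ifs with h
  · exact Finsupp.filter_single_of_pos _ h
  · exact Finsupp.filter_single_of_neg _ h

/-- The contraction of the chains of sites. -/
noncomputable def contraction : LatticeContraction ops where
  ka := axisHomotopy (fun x => x.a) fun x i => { x with a := i }
  kb := axisHomotopy (fun x => x.b) fun x i => { x with b := i }
  kc := axisHomotopy (fun x => x.c) fun x i => { x with c := i }
  kd := axisHomotopy (fun x => x.d) fun x i => { x with d := i }
  pa := push fun x => { x with a := 0 }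
  pb := push fun x => { x with b := 0 }
  pc := push fun x => { x with c := 0 }
  pd := push fun x => { x with d := 0 }
  r := base
  A_ka := push_shift_axisHomotopy (fun _ _ => rfl) fun _ => rfl
  B_kb := push_shift_axisHomotopy (fun _ _ => rfl) fun _ => rfl
  C_kc := push_shift_axisHomotopy (fun _ _ => rfl) fun _ => rfl
  D_kd := push_shift_axisHomotopy (fun _ _ => rfl) fun _ => rfl
  ka_A := axisHomotopy_push_shift (fun _ => rfl) (fun _ _ => rfl) fun _ => rfl
  kb_B := axisHomotopy_push_shift (fun _ => rfl) (fun _ _ => rfl) fun _ => rfl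
  kc_C := axisHomotopy_push_shift (fun _ => rfl) (fun _ _ => rfl) fun _ => rfl
  kd_D := axisHomotopy_push_shift (fun _ => rfl) (fun _ _ => rfl) fun _ => rfl
  pa_A m := push_push _ _ m
  pb_B m := push_push _ _ m
  pc_C m := push_push _ _ m
  pd_D m := push_push _ _ m
  ka_B := axisHomotopy_push_comm (fun _ => rfl) fun _ _ => rfl
  ka_C := axisHomotopy_push_comm (fun _ => rfl) fun _ _ => rfl
  ka_D := axisHomotopy_push_comm (fun _ => rfl) fun _ _ => rfl
  kb_A := axisHomotopy_push_comm (fun _ => rfl) fun _ _ => rfl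
  kb_C := axisHomotopy_push_comm (fun _ => rfl) fun _ _ => rfl
  kb_D := axisHomotopy_push_comm (fun _ => rfl) fun _ _ => rfl
  kc_A := axisHomotopy_push_comm (fun _ => rfl) fun _ _ => rfl
  kc_B := axisHomotopy_push_comm (fun _ => rfl) fun _ _ => rfl
  kc_D := axisHomotopy_push_comm (fun _ => rfl) fun _ _ => rfl
  kd_A := axisHomotopy_push_comm (fun _ => rfl) fun _ _ => rfl
  kd_B := axisHomotopy_push_comm (fun _ => rfl) fun _ _ => rfl
  kd_C := axisHomotopy_push_comm (fun _ => rfl) fun _ _ => rfl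
  pa_B := push_comm fun _ => rfl
  pa_C := push_comm fun _ => rfl
  pa_D := push_comm fun _ => rfl
  pb_A := push_comm fun _ => rfl
  pb_C := push_comm fun _ => rfl
  pb_D := push_comm fun _ => rfl
  pc_A := push_comm fun _ => rfl
  pc_B := push_comm fun _ => rfl
  pc_D := push_comm fun _ => rfl
  pd_A := push_comm fun _ => rfl
  pd_B := push_comm fun _ => rfl
  pd_C := push_comm fun _ => rfl
  p_g m := by
    simp only [ops, push_push]
    refine congrArg (push · m) (funext fun x => ?_)
    simp [turn]
  p_p m := by simp only [push_push]; rfl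
  g_r m := by
    refine addHom_ext (f := base + (ops.g.comp (base.comp (ops.g.comp (ops.g.comp ops.g)))) +
      (ops.g.comp (ops.g.comp (base.comp (ops.g.comp ops.g)))) +
      (ops.g.comp (ops.g.comp (ops.g.comp (base.comp ops.g))))) (h := AddMonoidHom.id _)
      (fun x => ?_) m
    simp only [AddMonoidHom.add_apply, AddMonoidHom.comp_apply, ops, push_single, base_single,
      AddMonoidHom.id_apply]
    have h4 := turn_four x
    have hk : (turn x).k = x.k + 1 ∧ (turn (turn x)).k = x.k + 1 + 1 ∧
      (turn (turn (turn x))).k = x.k + 1 + 1 + 1 := ⟨rfl, rfl, rfl⟩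
    rw [hk.1, hk.2.1, hk.2.2]
    -- Exactly one of the four rotations of `x` has `k = 0`; its term returns `x`, by `turn_four` if
    -- it was rotated.
    obtain h | h | h | h : x.k = 0 ∨ x.k = 1 ∨ x.k = 2 ∨ x.k = 3 := by
      generalize x.k = k
      revert k; decide
    all_goals rw [h]; simp +decide [h4]

/-- The sum of the coefficients of a chain. -/
noncomputable def augmentation : (Site →₀ ℤ) →+ ℤ := Finsupp.liftAddHom fun _ => AddMonoidHom.id ℤ

@[simp] theorem augmentation_single (x : Site) (n : ℤ) :
    augmentation (Finsupp.single x n) = n := by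
  simp [augmentation]

/-- The sites over the origin form one orbit of `turn`, so all have the same norm. Thus augmentation
zero supplies the degree-zero hypothesis of `exists_total_eq`. -/
theorem norm_origin (m : Site →₀ ℤ) : ops.norm (contraction.origin m) =
    augmentation m • ops.norm (Finsupp.single ⟨0, 0, 0, 0, 0⟩ 1) := by
  let n : (Site →₀ ℤ) →+ (Site →₀ ℤ) := AddMonoidHom.id _ + ops.g + ops.g.comp ops.g +
    ops.g.comp (ops.g.comp ops.g)
  let p : (Site →₀ ℤ) →+ (Site →₀ ℤ) :=
    contraction.pc.comp (contraction.pd.comp (contraction.pb.comp contraction.pa))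
  refine addHom_ext (f := n.comp p)
    (h := (zmultiplesHom _ (ops.norm (Finsupp.single ⟨0, 0, 0, 0, 0⟩ 1))).comp augmentation)
    (fun x => ?_) m
  obtain ⟨k, a, b, c, d⟩ := x
  simp only [n, p, LatticeOps.norm, contraction, ops, AddMonoidHom.add_apply,
    AddMonoidHom.comp_apply, AddMonoidHom.id_apply, push_single, turn, augmentation_single,
    zmultiplesHom_apply, one_smul, neg_zero]
  obtain rfl | rfl | rfl | rfl : k = 0 ∨ k = 1 ∨ k = 2 ∨ k = 3 := by revert k; decide
  · rfl
  all_goals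
    reduce_mod_char
    abel

end Site

/-! ### The free action of the crystallographic group on the sites -/

open Matrix

namespace Site

/-- The power of the holonomy matrix with exponent a class modulo four. -/
def holonomyPow (k : ZMod 4) : Matrix (Fin 4) (Fin 4) ℤ := holonomyMatrix ^ k.val

theorem holonomyPow_add (k l : ZMod 4) : holonomyPow (k + l) = holonomyPow k * holonomyPow l :=
  holonomyMatrix_pow_val_add k l

@[simp] theorem holonomyPow_zero : holonomyPow 0 = 1 := by simp [holonomyPow]

theorem holonomyPow_neg_one : holonomyPow (-1) =
    !![0, -1, 0, 1; 1, 0, 0, 0; 0, 0, -1, 1; 0, 0, 0, 1] := by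
  decide +kernel

/-- Translation of a site by a vector of the lattice of the crystallographic group. -/
def translate (v : Fin 4 → ℤ) (k : ZMod 4) (x : Site) : Site :=
  ⟨k, x.a + v 0, x.b + v 1, x.c + (v 0 + v 1 + v 2 + 2 * v 3), x.d + v 2⟩

/-- The action of the crystallographic group on the sites by left multiplication. -/
def act (γ : CrystalGroup) (x : Site) : Site :=
  translate (γ.left.toAdd ᵥ* holonomyPow (-(γ.right.toAdd + x.k))) (γ.right.toAdd + x.k) x

/-- A site stands for a rotation followed by a translation in a product. Moving the lattice part of
`γ` past the rotation `k` twists it by `M ^ (-k)`. -/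
theorem act_mul (γ δ : CrystalGroup) (x : Site) : act (γ * δ) x = act γ (act δ x) := by
  have h1 : (γ * δ).right.toAdd = γ.right.toAdd + δ.right.toAdd := rfl
  have h2 : (γ * δ).left.toAdd =
    γ.left.toAdd + δ.left.toAdd ᵥ* holonomyPow γ.right.toAdd := rfl
  have h3 : holonomyPow γ.right.toAdd *
      holonomyPow (-(γ.right.toAdd + δ.right.toAdd + x.k)) =
      holonomyPow (-(δ.right.toAdd + x.k)) := by
    rw [← holonomyPow_add]; congr 1; ring
  have h4 : (act δ x).k = δ.right.toAdd + x.k := rfl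
  rw [act, h1, h2, add_vecMul, vecMul_vecMul, h3, act, h4, ← add_assoc]
  ext <;> simp [act, translate] <;> ring

instance : MulAction CrystalGroup Site where
  smul := act
  one_smul x := by
    change act 1 x = x
    ext <;> simp [act, translate]
  mul_smul := act_mul

theorem smul_def (γ : CrystalGroup) (x : Site) : γ • x =
    translate (γ.left.toAdd ᵥ* holonomyPow (-(γ.right.toAdd + x.k))) (γ.right.toAdd + x.k) x := rfl

/-- Left and right multiplication commute. Concretely, `M⁻¹` becomes the signed permutation `(a, b,
c, d) ↦ (b, -a, c, -d)`. -/
theorem turn_smul (γ : CrystalGroup) (x : Site) : turn (γ • x) = γ • turn x := by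
  have h : holonomyPow (-(γ.right.toAdd + (turn x).k)) =
      holonomyPow (-(γ.right.toAdd + x.k)) * holonomyPow (-1) := by
    rw [← holonomyPow_add]; congr 1; simp only [turn]; ring
  rw [smul_def, smul_def, h, ← vecMul_vecMul, holonomyPow_neg_one]
  generalize γ.left.toAdd ᵥ* holonomyPow (-(γ.right.toAdd + x.k)) = v
  ext <;> simp [turn, translate, vecMul, dotProduct, Fin.sum_univ_four] <;> ring

/-- Representatives of the two orbits of sites. -/
def rep (e : Bool) : Site := ⟨0, 0, 0, if e then 1 else 0, 0⟩

theorem smul_rep_bijective :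
    Function.Bijective fun p : CrystalGroup × Bool => p.1 • rep p.2 := by
  constructor
  · rintro ⟨γ, e⟩ ⟨δ, f⟩ h
    simp only [smul_def, translate, rep, Site.mk.injEq, add_zero, zero_add] at h
    obtain ⟨hk, ha, hb, hc, hd⟩ := h
    rw [← hk] at ha hb hc hd
    -- With `a`, `b`, `d` matched, the `c` coordinates differ by an even number plus the difference
    -- of the representatives.
    have hef : e = f := by
      cases e <;> cases f <;> simp at hc ⊢ <;> omega
    subst hef
    have hv : γ.left.toAdd ᵥ* holonomyPow (-γ.right.toAdd) =
        δ.left.toAdd ᵥ* holonomyPow (-γ.right.toAdd) := by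
      funext i
      fin_cases i
      · exact ha
      · exact hb
      · exact hd
      · change (γ.left.toAdd ᵥ* holonomyPow (-γ.right.toAdd)) 3 =
          (δ.left.toAdd ᵥ* holonomyPow (-γ.right.toAdd)) 3
        omega
    have hl := congrArg (· ᵥ* holonomyPow γ.right.toAdd) hv
    simp only [vecMul_vecMul, ← holonomyPow_add, neg_add_cancel, holonomyPow_zero,
      vecMul_one] at hl
    exact Prod.ext (SemidirectProduct.ext hl hk) rfl
  · rintro ⟨k, a, b, c, d⟩
    obtain ⟨e, q, he⟩ : ∃ (e : Bool) (q : ℤ), c - a - b - d = 2 * q + if e then 1 else 0 := by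
      rcases Int.emod_two_eq_zero_or_one (c - a - b - d) with h | h
      · exact ⟨false, (c - a - b - d) / 2, by simp; omega⟩
      · exact ⟨true, (c - a - b - d) / 2, by simp; omega⟩
    -- The factor `holonomyPow k` cancels the twist in the action; `q` solves `c = a + b + d + 2q`
    -- up to parity.
    refine ⟨(⟨Multiplicative.ofAdd (![a, b, d, q] ᵥ* holonomyPow k), Multiplicative.ofAdd k⟩, e), ?_⟩
    simp only [smul_def, rep, toAdd_ofAdd, add_zero, vecMul_vecMul, ← holonomyPow_add,
      add_neg_cancel, holonomyPow_zero, vecMul_one]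
    ext <;> simp [translate]
    linarith

/-- The sites form a free set over the crystallographic group, with two orbits. -/
noncomputable def siteEquiv : CrystalGroup × Bool ≃ Site :=
  Equiv.ofBijective _ smul_rep_bijective

theorem siteEquiv_symm_smul_rep (γ : CrystalGroup) (e : Bool) :
    siteEquiv.symm (γ • rep e) = (γ, e) := siteEquiv.symm_apply_apply (γ, e)

theorem exists_smul_rep (x : Site) : ∃ (γ : CrystalGroup) (e : Bool), γ • rep e = x :=
  let ⟨p, hp⟩ := smul_rep_bijective.2 x
  ⟨p.1, p.2, hp⟩

end Site

/-! ### The projective resolution of the trivial module -/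

open CategoryTheory

namespace LatticeOps

variable {M N : Type*} [AddCommGroup M] [AddCommGroup N]

/-- An additive map commuting with the operators of two lattice modules. -/
structure Hom (o : LatticeOps M) (o' : LatticeOps N) where
  map : M →+ N
  map_A : ∀ m, map (o.A m) = o'.A (map m)
  map_B : ∀ m, map (o.B m) = o'.B (map m)
  map_Bi : ∀ m, map (o.Bi m) = o'.Bi (map m)
  map_C : ∀ m, map (o.C m) = o'.C (map m)
  map_D : ∀ m, map (o.D m) = o'.D (map m)
  map_Di : ∀ m, map (o.Di m) = o'.Di (map m)
  map_g : ∀ m, map (o.g m) = o'.g (map m)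

variable {o : LatticeOps M} {o' : LatticeOps N} (φ : Hom o o')

theorem Hom.koszul (x : Cell → M) : o'.koszul (φ.map ∘ x) = φ.map ∘ o.koszul x := by
  funext ⟨a, b, d, c⟩
  cases a <;> cases b <;> cases d <;> cases c <;>
    simp [LatticeOps.koszul, φ.map_A, φ.map_B, φ.map_C, φ.map_D]

theorem Hom.rotate (x : Cell → M) : o'.rotate (φ.map ∘ x) = φ.map ∘ o.rotate x := by
  funext ⟨a, b, d, c⟩
  cases a <;> cases b <;> cases d <;>
    simp [LatticeOps.rotate, φ.map_Bi, φ.map_Di, φ.map_g]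

theorem Hom.periodic (p : ℕ) (x : Cell → M) :
    o'.periodic p (φ.map ∘ x) = φ.map ∘ o.periodic p x := by
  unfold LatticeOps.periodic
  split_ifs
  · funext J; simp
  · rw [φ.rotate]; funext J; simp
  · simp only [φ.rotate]; funext J; simp

theorem Hom.total (n : ℕ) (x : Cell → M) : o'.total n (φ.map ∘ x) = φ.map ∘ o.total n x := by
  funext J
  simp [LatticeOps.total, φ.koszul, φ.periodic]

end LatticeOps

namespace Site

/-- The action of an element of the crystallographic group commutes with the operators. -/
noncomputable def smulHom (γ : CrystalGroup) : LatticeOps.Hom ops ops where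
  map := push (γ • ·)
  map_A := push_comm fun x => by ext <;> simp [smul_def, translate]; ring
  map_B := push_comm fun x => by ext <;> simp [smul_def, translate]; ring
  map_Bi := push_comm fun x => by ext <;> simp [smul_def, translate]; ring
  map_C := push_comm fun x => by ext <;> simp [smul_def, translate]; ring
  map_D := push_comm fun x => by ext <;> simp [smul_def, translate]; ring
  map_Di := push_comm fun x => by ext <;> simp [smul_def, translate]; ring
  map_g := push_comm fun x => (turn_smul γ x).symm

/-- The representation of the crystallographic group on the cellular chains. -/
noncomputable def chainRep : Representation ℤ CrystalGroup (Cell → Site →₀ ℤ) where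
  toFun γ := (Finsupp.lmapDomain ℤ ℤ (γ • ·)).compLeft Cell
  map_one' := by
    refine LinearMap.ext fun x => funext fun J => ?_
    exact push_eq_self (fun y => one_smul _ y) (x J)
  map_mul' γ δ := by
    refine LinearMap.ext fun x => funext fun J => ?_
    refine Eq.trans ?_ (push_push (γ • ·) (δ • ·) (x J)).symm
    exact congrArg (push · (x J)) (funext fun y => mul_smul γ δ y)

theorem chainRep_apply (γ : CrystalGroup) (x : Cell → Site →₀ ℤ) :
    chainRep γ x = (smulHom γ).map ∘ x := rfl

/-- The chain supported at one site of one cell. -/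
noncomputable def basis (J : Cell) (y : Site) : Cell → Site →₀ ℤ :=
  Pi.single J (Finsupp.single y 1)

theorem chainRep_basis (γ : CrystalGroup) (J : Cell) (y : Site) :
    chainRep γ (basis J y) = basis J (γ • y) := by
  funext K
  rw [chainRep_apply, Function.comp_apply]
  rcases eq_or_ne K J with rfl | h
  · simp [basis, smulHom]
  · simp [basis, Pi.single_eq_of_ne h]

section

variable {V : Type*} [AddCommGroup V] [inst : Module ℤ V]

theorem chain_hom_ext {f h : (Cell → Site →₀ ℤ) →ₗ[ℤ] V}
    (H : ∀ J y, f (basis J y) = h (basis J y)) : f = h := by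
  refine LinearMap.pi_ext' fun J => ?_
  refine Finsupp.lhom_ext' fun y => ?_
  ext
  exact H J y

variable (ρ : Representation ℤ CrystalGroup V)

/-- An equivariant map on chains is determined by its values on the representatives. -/
theorem chain_rep_ext {f h : chainRep.IntertwiningMap ρ}
    (H : ∀ J e, f (basis J (rep e)) = h (basis J (rep e))) : f = h := by
  refine Representation.IntertwiningMap.toLinearMap_injective _ _ (chain_hom_ext fun J y => ?_)
  obtain ⟨γ, e, rfl⟩ := exists_smul_rep y
  have h1 := congrArg (· (basis J (rep e))) (f.isIntertwining' γ)
  have h2 := congrArg (· (basis J (rep e))) (h.isIntertwining' γ)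
  simp only [LinearMap.comp_apply, chainRep_basis] at h1 h2
  exact h1.trans (Eq.trans (congrArg (ρ γ) (H J e)) h2.symm)

/-- The linear map on chains with prescribed values on the representatives. -/
noncomputable def chainLiftLinear (s : Cell → Bool → V) : (Cell → Site →₀ ℤ) →ₗ[ℤ] V :=
  ∑ J, (Finsupp.linearCombination ℤ fun y =>
    ρ (siteEquiv.symm y).1 (s J (siteEquiv.symm y).2)) ∘ₗ LinearMap.proj J

theorem chainLiftLinear_basis (s : Cell → Bool → V) (J : Cell) (y : Site) :
    chainLiftLinear ρ s (basis J y) = ρ (siteEquiv.symm y).1 (s J (siteEquiv.symm y).2) := by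
  simp only [chainLiftLinear, LinearMap.sum_apply, LinearMap.comp_apply, LinearMap.proj_apply]
  rw [Finset.sum_eq_single J]
  · simp only [basis, Pi.single_eq_same, Finsupp.linearCombination_single]
    exact inst.one_smul _
  · intro K _ hK
    simp [basis, Pi.single_eq_of_ne hK]
  · simp

/-- The equivariant map on chains with prescribed values on the representatives. -/
noncomputable def chainLift (s : Cell → Bool → V) : chainRep.IntertwiningMap ρ :=
  ⟨chainLiftLinear ρ s, fun γ => by
    refine chain_hom_ext fun J y => ?_
    obtain ⟨δ, e, rfl⟩ := exists_smul_rep y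
    simp only [LinearMap.comp_apply, chainRep_basis, chainLiftLinear_basis, smul_smul,
      siteEquiv_symm_smul_rep, map_mul, Module.End.mul_apply]⟩

theorem chainLift_basis (s : Cell → Bool → V) (J : Cell) (e : Bool) :
    chainLift ρ s (basis J (rep e)) = s J e := by
  refine (chainLiftLinear_basis ρ s J (rep e)).trans ?_
  have : siteEquiv.symm (rep e) = (1, e) := by
    rw [← siteEquiv_symm_smul_rep, one_smul]
  simp [this]

end

/-- Chains are free on the pairs of a cell and an orbit, so a lift is fixed by choosing preimages of
these generators. -/
instance : Projective (Rep.of chainRep) where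
  factors {E X} f e _ := by
    have he : Function.Surjective e.hom := (Rep.epi_iff_surjective e).1 inferInstance
    let s : Cell → Bool → E := fun J b => Function.surjInv he (f.hom (basis J (rep b)))
    refine ⟨ConcreteCategory.ofHom (@chainLift E _ E.hV2 E.ρ s), ?_⟩
    refine Rep.hom_injective (@chain_rep_ext X _ X.hV2 X.ρ _ _ fun J b => ?_)
    refine Eq.trans (congrArg e.hom (@chainLift_basis E _ E.hV2 E.ρ s J b)) ?_
    exact Function.surjInv_eq he _

/-- The chains of cells of dimension at most `n`. -/
def chainSubmodule (n : ℕ) : Submodule ℤ (Cell → Site →₀ ℤ) where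
  carrier := {x | ∀ J : Cell, n < J.dim → x J = 0}
  add_mem' hx hy J hJ := by rw [Pi.add_apply, hx J hJ, hy J hJ, add_zero]
  zero_mem' _ _ := rfl
  smul_mem' k x hx J hJ := by rw [Pi.smul_apply, hx J hJ, smul_zero]

/-- The term of degree `n` of the resolution. -/
noncomputable abbrev chains (n : ℕ) : Rep ℤ CrystalGroup :=
  Rep.subrepresentation (Rep.of chainRep) (chainSubmodule n) fun γ x hx J hJ => by
    change (smulHom γ).map (x J) = 0
    rw [hx J hJ, map_zero]

/-- The truncation of chains to dimension at most `n`. -/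
noncomputable def truncation (n : ℕ) : (Cell → Site →₀ ℤ) →ₗ[ℤ] chainSubmodule n where
  toFun x := ⟨fun J => if n < J.dim then 0 else x J, fun J hJ => if_pos hJ⟩
  map_add' x y := by
    ext J : 2
    dsimp
    split_ifs <;> simp
  map_smul' k x := by
    ext J : 2
    dsimp
    split_ifs <;> simp

/-- The truncation as an equivariant map. -/
noncomputable def truncationHom (n : ℕ) : Rep.of chainRep ⟶ chains n :=
  Rep.ofHom ⟨truncation n, fun γ => by
    refine LinearMap.ext fun x => Subtype.ext (funext fun J => ?_)
    change (if n < J.dim then 0 else (smulHom γ).map (x J)) =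
      (smulHom γ).map (if n < J.dim then 0 else x J)
    split_ifs <;> simp⟩

theorem truncation_coe (n : ℕ) (x : chainSubmodule n) : truncation n x = x := by
  ext J : 2
  change (if n < J.dim then 0 else x.1 J) = x.1 J
  split_ifs with h
  · exact (x.2 J h).symm
  · rfl

instance (n : ℕ) : Projective (chains n) :=
  Retract.projective ⟨Rep.subtype _ _ _, truncationHom n,
    Rep.hom_injective (Representation.IntertwiningMap.toLinearMap_injective _ _
      (LinearMap.ext fun x => truncation_coe n x))⟩

end Site

theorem Rep.exact_of_forall_exists {k G : Type} [CommRing k] [Group G]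
    (S : ShortComplex (Rep.{0} k G)) (h : ∀ x, S.g.hom x = 0 → ∃ y, S.f.hom y = x) : S.Exact := by
  apply (forget₂ (Rep.{0} k G) (ModuleCat.{0} k)).reflects_exact_of_faithful
  rw [ShortComplex.moduleCat_exact_iff]
  exact h

namespace Site

/-- The differential of the resolution as a linear map. -/
noncomputable def differentialLinear (n : ℕ) : chainSubmodule (n + 1) →ₗ[ℤ] chainSubmodule n where
  toFun x := ⟨ops.total (n + 1) x, fun _ hJ => ops.total_eq_zero_of_lt x.2 hJ⟩
  map_add' _ _ := Subtype.ext (ops.total_add _ _ _)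
  map_smul' k x := Subtype.ext (map_zsmul (ops.totalHom (n + 1)) k x.1)

/-- The differential of the resolution. -/
noncomputable def differential (n : ℕ) : chains (n + 1) ⟶ chains n :=
  Rep.ofHom ⟨differentialLinear n, fun γ => LinearMap.ext fun x => Subtype.ext
    ((smulHom γ).total (n + 1) x.1)⟩

theorem differential_comp (n : ℕ) : differential (n + 1) ≫ differential n = 0 :=
  Rep.hom_injective (Representation.IntertwiningMap.toLinearMap_injective _ _
    (LinearMap.ext fun x => Subtype.ext (ops.total_total (n + 1) x.1)))

theorem augmentation_push (f : Site → Site) (m : Site →₀ ℤ) :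
    augmentation (push f m) = augmentation m :=
  addHom_ext (f := augmentation.comp (push f)) (h := augmentation) (fun x => by simp) m

/-- At the vertex every term has the form `T y - y`, up to sign, with `T` preserving the coefficient
sum. -/
theorem augmentation_total_one (x : Cell → Site →₀ ℤ) :
    augmentation (ops.total 1 x (false, false, false, false)) = 0 := by
  have h := ops.periodic_vertex 1 x
  have hp : ∀ f : (Site →₀ ℤ) →+ (Site →₀ ℤ), f ∈ Set.range push →
      ∀ m, augmentation (f m) = augmentation m := by
    rintro _ ⟨f, rfl⟩ m
    exact augmentation_push f m
  simp only [LatticeOps.total, Cell.dim]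
  simp [h, LatticeOps.koszul, hp ops.A ⟨_, rfl⟩, hp ops.B ⟨_, rfl⟩, hp ops.C ⟨_, rfl⟩,
    hp ops.D ⟨_, rfl⟩, hp ops.g ⟨_, rfl⟩]

/-- The augmentation of the resolution as a linear map. -/
noncomputable def augmentationLinear : chainSubmodule 0 →ₗ[ℤ] ℤ where
  toFun x := augmentation (x.1 (false, false, false, false))
  map_add' _ _ := map_add augmentation _ _
  map_smul' k _ := map_zsmul augmentation k _

/-- The augmentation of the resolution. -/
noncomputable def augmentationHom : chains 0 ⟶ Rep.trivial ℤ CrystalGroup ℤ :=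
  Rep.ofHom ⟨augmentationLinear, fun _ => LinearMap.ext fun _ => augmentation_push _ _⟩

theorem differential_comp_augmentationHom : differential 0 ≫ augmentationHom = 0 :=
  Rep.hom_injective (Representation.IntertwiningMap.toLinearMap_injective _ _
    (LinearMap.ext fun x => augmentation_total_one x.1))

theorem exact_differential (n : ℕ) : LinearMap.range (differentialLinear (n + 1)) =
    LinearMap.ker (differentialLinear n) := by
  refine le_antisymm ?_ fun x hx => ?_
  · rintro _ ⟨x, rfl⟩
    exact Subtype.ext (ops.total_total (n + 1) x.1)
  · obtain ⟨y, hy, hy'⟩ := contraction.exists_total_eq x.2 (congrArg Subtype.val hx) (by simp)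
    exact ⟨⟨y, hy⟩, Subtype.ext hy'⟩

theorem exact_augmentation : LinearMap.range (differentialLinear 0) =
    LinearMap.ker augmentationLinear := by
  refine le_antisymm ?_ fun x hx => ?_
  · rintro _ ⟨x, rfl⟩
    exact augmentation_total_one x.1
  · obtain ⟨y, hy, hy'⟩ := contraction.exists_total_eq x.2 (ops.total_zero_eq_zero x.2)
      (fun _ => by
        have : augmentation (x.1 (false, false, false, false)) = 0 := hx
        rw [norm_origin, this, zero_smul])
    exact ⟨⟨y, hy⟩, Subtype.ext hy'⟩

/-- The chain complex underlying the resolution. -/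
noncomputable def chainComplex : ChainComplex (Rep ℤ CrystalGroup) ℕ :=
  ChainComplex.of chains differential differential_comp

theorem chainComplex_d (n : ℕ) : chainComplex.d (n + 1) n = differential n :=
  ChainComplex.of_d _ _ _

/-- The augmentation as a map of complexes. -/
noncomputable def resolutionMap : chainComplex ⟶
    (ChainComplex.single₀ (Rep ℤ CrystalGroup)).obj (Rep.trivial ℤ CrystalGroup ℤ) :=
  (chainComplex.toSingle₀Equiv _).symm ⟨augmentationHom, by
    rw [chainComplex_d]; exact differential_comp_augmentationHom⟩

theorem resolutionMap_f_zero : resolutionMap.f 0 = augmentationHom :=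
  ChainComplex.toSingle₀Equiv_symm_apply_f_zero _ _

theorem quasiIso_resolutionMap : QuasiIso resolutionMap where
  quasiIsoAt m := by
    cases m with
    | zero =>
      rw [ChainComplex.quasiIsoAt₀_iff, ShortComplex.quasiIso_iff_of_zeros' _ rfl rfl rfl]
      constructor
      · refine Rep.exact_of_forall_exists _ fun x hx => ?_
        change (resolutionMap.f 0).hom x = 0 at hx
        change ∃ y, (chainComplex.d 1 0).hom y = x
        rw [resolutionMap_f_zero] at hx
        rw [chainComplex_d]
        exact exact_augmentation.ge hx
      · rw [Rep.epi_iff_surjective]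
        change Function.Surjective (resolutionMap.f 0).hom
        rw [resolutionMap_f_zero]
        intro n
        refine ⟨truncation 0 (Pi.single (false, false, false, false) (Finsupp.single (rep false) n)),
          ?_⟩
        change augmentation (if 0 < 0 then 0 else _) = n
        simp only [lt_irrefl, if_false, Pi.single_eq_same]
        exact augmentation_single _ _
    | succ m =>
      rw [quasiIsoAt_iff_exactAt' (hL := ChainComplex.exactAt_succ_single_obj ..),
          HomologicalComplex.exactAt_iff' _ (m + 2) (m + 1) m (by simp) (by simp)]
      refine Rep.exact_of_forall_exists _ fun x hx => ?_
      change (chainComplex.d (m + 1) m).hom x = 0 at hx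
      change ∃ y, (chainComplex.d (m + 2) (m + 1)).hom y = x
      rw [chainComplex_d] at hx ⊢
      exact (exact_differential m).ge hx

/-- A projective resolution of the trivial module `ℤ` over the crystallographic group. -/
noncomputable def resolution : ProjectiveResolution (Rep.trivial ℤ CrystalGroup ℤ) where
  complex := chainComplex
  projective n := inferInstanceAs (Projective (chains n))
  π := resolutionMap
  quasiIso := quasiIso_resolutionMap

end Site

/-! ### Cochains as integer vectors and the coboundary matrices -/

/-- A criterion to identify a cohomology module of a cochain complex. -/
theorem CochainComplex.nonempty_homology_equiv {R : Type} [CommRing R]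
    (K : CochainComplex (ModuleCat.{0} R) ℕ) (m : ℕ) {Q : Type} [AddCommGroup Q] [Module R Q]
    (φ : K.X (m + 1) →ₗ[R] Q) (h1 : ∀ q, ∃ x, K.d (m + 1) (m + 2) x = 0 ∧ φ x = q)
    (h2 : ∀ x, K.d (m + 1) (m + 2) x = 0 → (φ x = 0 ↔ ∃ y, K.d m (m + 1) y = x)) :
    Nonempty (K.homology (m + 1) ≃+ Q) := by
  let S := K.sc' m (m + 1) (m + 2)
  let ψ : LinearMap.ker S.g.hom →ₗ[R] Q := φ ∘ₗ Submodule.subtype _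
  have hψ : Function.Surjective ψ := fun q => by
    obtain ⟨x, hx, hq⟩ := h1 q
    exact ⟨⟨x, hx⟩, hq⟩
  have hr : LinearMap.range S.moduleCatToCycles = LinearMap.ker ψ := by
    ext ⟨x, hx⟩
    rw [LinearMap.mem_ker]
    refine Iff.trans ?_ (h2 x hx).symm
    constructor
    · rintro ⟨y, hy⟩
      exact ⟨y, congrArg Subtype.val hy⟩
    · rintro ⟨y, hy⟩
      exact ⟨y, Subtype.ext hy⟩
  exact ⟨(((K.homologyIsoSc' m (m + 1) (m + 2) (by simp) (by simp)) ≪≫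
    S.moduleCatHomologyIso).toLinearEquiv.trans ((Submodule.quotEquivOfEq _ _ hr).trans
    (ψ.quotKerEquivOfSurjective hψ))).toAddEquiv⟩

/-- The `ℤ`-module structures are arbitrary instances, so the lemma applies to the structure carried
by a cochain module. Additive maps respect any of them. -/
theorem AddMonoidHom.map_int_module_smul {M N : Type*} [AddCommGroup M] [AddCommGroup N]
    [Module ℤ M] [Module ℤ N] (f : M →+ N) (c : ℤ) (x : M) : f (c • x) = c • f x := by
  simp

namespace Site

/-- The cells of the unit cube together with a parity, numbered from `0` to `31`. -/
def decode (i : Fin 32) : Cell × Bool :=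
  ((i.val.testBit 4, i.val.testBit 3, i.val.testBit 2, i.val.testBit 1), i.val.testBit 0)

/-- The number of a cell with a parity. -/
def encode (J : Cell) (e : Bool) : Fin 32 :=
  ⟨16 * J.1.toNat + 8 * J.2.1.toNat + 4 * J.2.2.1.toNat + 2 * J.2.2.2.toNat + e.toNat, by
    revert J e; decide⟩

theorem encode_decode (i : Fin 32) : encode (decode i).1 (decode i).2 = i := by
  revert i; decide

theorem decode_encode (J : Cell) (e : Bool) : decode (encode J e) = (J, e) := by
  revert J e; decide

/-- The dimension of the cell with number `i`. -/
def dim (i : Fin 32) : ℕ := (decode i).1.dim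

/-- The operators induced on the chains of orbits of sites. -/
def orbitOps : LatticeOps (ℤ × ℤ) where
  A := (AddEquiv.prodComm : ℤ × ℤ ≃+ ℤ × ℤ).toAddMonoidHom
  Ai := (AddEquiv.prodComm : ℤ × ℤ ≃+ ℤ × ℤ).toAddMonoidHom
  B := (AddEquiv.prodComm : ℤ × ℤ ≃+ ℤ × ℤ).toAddMonoidHom
  Bi := (AddEquiv.prodComm : ℤ × ℤ ≃+ ℤ × ℤ).toAddMonoidHom
  C := (AddEquiv.prodComm : ℤ × ℤ ≃+ ℤ × ℤ).toAddMonoidHom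
  D := (AddEquiv.prodComm : ℤ × ℤ ≃+ ℤ × ℤ).toAddMonoidHom
  Di := (AddEquiv.prodComm : ℤ × ℤ ≃+ ℤ × ℤ).toAddMonoidHom
  g := AddMonoidHom.id _
  A_Ai _ := rfl
  Ai_A _ := rfl
  B_Bi _ := rfl
  Bi_B _ := rfl
  D_Di _ := rfl
  Di_D _ := rfl
  B_A _ := rfl
  B_Ai _ := rfl
  Bi_A _ := rfl
  Bi_Ai _ := rfl
  C_A _ := rfl
  C_Ai _ := rfl
  C_B _ := rfl
  C_Bi _ := rfl
  D_A _ := rfl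
  D_Ai _ := rfl
  D_B _ := rfl
  D_Bi _ := rfl
  D_C _ := rfl
  Di_A _ := rfl
  Di_Ai _ := rfl
  Di_B _ := rfl
  Di_Bi _ := rfl
  Di_C _ := rfl
  g_A _ := rfl
  g_Ai _ := rfl
  g_B _ := rfl
  g_Bi _ := rfl
  g_C _ := rfl
  g_D _ := rfl
  g_Di _ := rfl
  g_four _ := rfl

/-- The generator of the chains of orbits of the given parity. -/
def orbit (e : Bool) : ℤ × ℤ := if e then (0, 1) else (1, 0)

/-- The parity of a site, which determines its orbit. -/
def parity (x : Site) : Bool := decide (Odd (x.a + x.b + x.c + x.d))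

/-- The projection from chains of sites to chains of orbits. -/
noncomputable def orbitMap : (Site →₀ ℤ) →+ ℤ × ℤ :=
  Finsupp.liftAddHom fun x => zmultiplesHom _ (orbit (parity x))

theorem orbitMap_single (x : Site) : orbitMap (Finsupp.single x 1) = orbit (parity x) := by
  simp [orbitMap]

theorem orbitMap_push_swap {f : Site → Site} (hf : ∀ x, parity (f x) = !parity x)
    (m : Site →₀ ℤ) : orbitMap (push f m) = (orbitMap m).swap := by
  refine addHom_ext (f := orbitMap.comp (push f))
    (h := ((AddEquiv.prodComm : ℤ × ℤ ≃+ ℤ × ℤ).toAddMonoidHom).comp orbitMap) (fun x => ?_) m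
  simp only [AddMonoidHom.comp_apply, push_single, orbitMap_single, hf]
  cases parity x <;> rfl

theorem orbitMap_push {f : Site → Site} (hf : ∀ x, parity (f x) = parity x)
    (m : Site →₀ ℤ) : orbitMap (push f m) = orbitMap m := by
  refine addHom_ext (f := orbitMap.comp (push f)) (h := orbitMap) (fun x => ?_) m
  simp only [AddMonoidHom.comp_apply, push_single, orbitMap_single, hf]

/-- The projection to orbits commutes with the operators. -/
noncomputable def orbitHom : LatticeOps.Hom ops orbitOps where
  map := orbitMap
  map_A := orbitMap_push_swap fun x => by
    simp only [parity, ← decide_not, decide_eq_decide, Int.odd_iff]; omega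
  map_B := orbitMap_push_swap fun x => by
    simp only [parity, ← decide_not, decide_eq_decide, Int.odd_iff]; omega
  map_Bi := orbitMap_push_swap fun x => by
    simp only [parity, ← decide_not, decide_eq_decide, Int.odd_iff]; omega
  map_C := orbitMap_push_swap fun x => by
    simp only [parity, ← decide_not, decide_eq_decide, Int.odd_iff]; omega
  map_D := orbitMap_push_swap fun x => by
    simp only [parity, ← decide_not, decide_eq_decide, Int.odd_iff]; omega
  map_Di := orbitMap_push_swap fun x => by
    simp only [parity, ← decide_not, decide_eq_decide, Int.odd_iff]; omega
  map_g := orbitMap_push fun x => by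
    simp only [parity, turn, decide_eq_decide, Int.odd_iff]; omega

theorem parity_smul (γ : CrystalGroup) (x : Site) : parity (γ • x) = parity x := by
  simp only [parity, smul_def, translate, decide_eq_decide, Int.odd_iff]
  omega

theorem parity_rep (e : Bool) : parity (rep e) = e := by
  cases e <;> simp [parity, rep]

/-- The chain of orbits given by an orbit of sites of a cell. -/
def orbitBasis (i : Fin 32) : Cell → ℤ × ℤ :=
  fun J => if J = (decode i).1 then orbit (decode i).2 else 0

theorem orbitMap_comp_basis (J : Cell) (e : Bool) :
    orbitMap ∘ basis J (rep e) = orbitBasis (encode J e) := by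
  funext K
  simp only [orbitBasis, decode_encode, Function.comp_apply, basis]
  split_ifs with h
  · subst h
    rw [Pi.single_eq_same, orbitMap_single, parity_rep]
  · rw [Pi.single_eq_of_ne h, map_zero]

/-- The value of a cochain on a chain of orbits. -/
def pairing (F : Fin 32 → ℤ) : (Cell → ℤ × ℤ) →+ ℤ :=
  AddMonoidHom.mk' (fun y => ∑ J, (F (encode J false) * (y J).1 + F (encode J true) * (y J).2))
    fun y z => by
      rw [← Finset.sum_add_distrib]
      refine Finset.sum_congr rfl fun J _ => ?_
      simp only [Pi.add_apply, Prod.fst_add, Prod.snd_add]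
      ring

theorem pairing_orbitBasis (F : Fin 32 → ℤ) (i : Fin 32) : pairing F (orbitBasis i) = F i := by
  change ∑ J, (F (encode J false) * (orbitBasis i J).1 + F (encode J true) * (orbitBasis i J).2) = _
  rw [Finset.sum_eq_single (decode i).1]
  · conv_rhs => rw [← encode_decode i]
    simp only [orbitBasis, if_true, orbit]
    cases (decode i).2 <;> simp
  · intro J _ hJ
    simp [orbitBasis, hJ]
  · simp

/-- The matrix of the differential of degree `n` on chains of orbits. -/
def orbitMatrix (n : ℕ) : Matrix (Fin 32) (Fin 32) ℤ := fun i j =>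
  let m := orbitOps.total n (orbitBasis j) (decode i).1
  if (decode i).2 then m.2 else m.1

theorem pairing_total (F : Fin 32 → ℤ) (n : ℕ) (j : Fin 32) :
    pairing F (orbitOps.total n (orbitBasis j)) = Matrix.vecMul F (orbitMatrix n) j := by
  have h : ∀ f : Fin 32 → ℤ, ∑ i, f i = ∑ J, (f (encode J false) + f (encode J true)) := by
    intro f
    let E : Cell × Bool ≃ Fin 32 := ⟨fun p => encode p.1 p.2, decode,
      fun p => decode_encode p.1 p.2, encode_decode⟩
    rw [← E.sum_comp f, Fintype.sum_prod_type]
    refine Finset.sum_congr rfl fun J _ => ?_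
    rw [Fintype.sum_bool, add_comm]
    rfl
  rw [Matrix.vecMul, dotProduct, h]
  simp [orbitMatrix, decode_encode, pairing]

end Site

theorem LatticeOps.total_congr {M : Type*} [AddCommGroup M] (o : LatticeOps M) {n : ℕ}
    {x y : Cell → M} {J : Cell}
    (h : ∀ K : Cell, K.dim = J.dim ∨ K.dim = J.dim + 1 → x K = y K) :
    o.total n x J = o.total n y J := by
  simp only [LatticeOps.total]
  rw [o.koszul_congr fun K hK => h K (Or.inr hK), o.periodic_congr fun K hK => h K (Or.inl hK)]

namespace Site

/-- The trivial module. -/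
noncomputable abbrev trivialRep : Rep ℤ CrystalGroup := Rep.trivial ℤ CrystalGroup ℤ

theorem orbitMatrix_eq_zero {n : ℕ} {k i : Fin 32} (h : dim k + 1 < dim i) :
    orbitMatrix n k i = 0 := by
  have : orbitOps.total n (orbitBasis i) (decode k).1 = orbitOps.total n 0 (decode k).1 :=
    orbitOps.total_congr fun K hK => if_neg (by
      rintro rfl
      simp only [dim] at h
      omega)
  have h0 : orbitOps.total n 0 = 0 := map_zero (orbitOps.totalHom n)
  simp [orbitMatrix, this, h0]

/-- The coordinates of a cochain. -/
noncomputable def coord (n : ℕ) : (chains n ⟶ trivialRep) →+ (Fin 32 → ℤ) :=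
  AddMonoidHom.mk' (fun f i => f.hom (truncation n (basis (decode i).1 (rep (decode i).2))))
    fun _ _ => rfl

theorem coord_apply {n : ℕ} (f : chains n ⟶ trivialRep) (i : Fin 32) :
    coord n f i = f.hom (truncation n (basis (decode i).1 (rep (decode i).2))) := rfl

theorem truncation_basis {n : ℕ} {J : Cell} (h : n < J.dim) (y : Site) :
    truncation n (basis J y) = 0 := by
  refine Subtype.ext (funext fun K => ?_)
  change (if n < K.dim then 0 else basis J y K) = 0
  split_ifs with hK
  · rfl
  · exact Pi.single_eq_of_ne (by rintro rfl; exact hK h) _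

theorem basis_mem {n : ℕ} {J : Cell} (h : J.dim ≤ n) (y : Site) :
    basis J y ∈ chainSubmodule n := fun K hK =>
  Pi.single_eq_of_ne (by rintro rfl; omega) _

theorem coord_eq_zero {n : ℕ} (f : chains n ⟶ trivialRep) {i : Fin 32} (h : n < dim i) :
    coord n f i = 0 := by
  rw [coord_apply, truncation_basis h]
  exact map_zero f.hom

/-- The equivariant functional on all chains given by a vector of coordinates. -/
noncomputable def functional (F : Fin 32 → ℤ) : Rep.of chainRep ⟶ trivialRep :=
  Rep.ofHom ⟨(pairing F).toIntLinearMap ∘ₗ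
    (AddMonoidHom.toIntLinearMap (AddMonoidHom.compLeft orbitMap Cell)), fun γ => by
      refine LinearMap.ext fun x => ?_
      change pairing F (orbitMap ∘ push (γ • ·) ∘ x) = pairing F (orbitMap ∘ x)
      congr 1
      funext J
      exact orbitMap_push (parity_smul γ) (x J)⟩

theorem functional_apply (F : Fin 32 → ℤ) (x : Cell → Site →₀ ℤ) :
    (functional F).hom x = pairing F (orbitMap ∘ x) := rfl

/-- The cochain with given coordinates. -/
noncomputable def cochain (n : ℕ) (F : Fin 32 → ℤ) : chains n ⟶ trivialRep :=
  Rep.subtype _ _ _ ≫ functional F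

theorem cochain_apply (n : ℕ) (F : Fin 32 → ℤ) (x : chainSubmodule n) :
    (cochain n F).hom x = pairing F (orbitMap ∘ x.1) := rfl

/-- With trivial coefficients a cochain factors through orbits; both sides agree on the
representatives. -/
theorem apply_eq_pairing {n : ℕ} (f : chains n ⟶ trivialRep) (x : chainSubmodule n) :
    f.hom x = pairing (coord n f) (orbitMap ∘ x.1) := by
  have h : truncationHom n ≫ f = functional (coord n f) := by
    refine Rep.hom_injective (chain_rep_ext _ fun J e => ?_)
    rw [functional_apply, orbitMap_comp_basis, pairing_orbitBasis, coord_apply, decode_encode]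
    rfl
  rw [← functional_apply, ← h]
  change _ = f.hom (truncation n x.1)
  rw [truncation_coe]

theorem coord_cochain {n : ℕ} {F : Fin 32 → ℤ} (hF : ∀ i, n < dim i → F i = 0) :
    coord n (cochain n F) = F := by
  funext i
  rcases lt_or_ge n (dim i) with h | h
  · rw [coord_eq_zero _ h, hF i h]
  · have h1 := truncation_coe n ⟨_, basis_mem h (rep (decode i).2)⟩
    rw [coord_apply, cochain_apply, h1, orbitMap_comp_basis, pairing_orbitBasis, encode_decode]

theorem coord_injective (n : ℕ) : Function.Injective (coord n) := fun f g h => by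
  refine Rep.hom_injective (Representation.IntertwiningMap.toLinearMap_injective _ _
    (LinearMap.ext fun x => ?_))
  change f.hom x = g.hom x
  rw [apply_eq_pairing, apply_eq_pairing, h]

theorem coord_differential {n : ℕ} (f : chains n ⟶ trivialRep) :
    coord (n + 1) (differential n ≫ f) = Matrix.vecMul (coord n f) (orbitMatrix (n + 1)) := by
  funext i
  rcases lt_or_ge (n + 1) (dim i) with h | h
  · rw [coord_eq_zero _ h, Matrix.vecMul, dotProduct]
    refine (Finset.sum_eq_zero fun k _ => ?_).symm
    -- A nonzero matrix entry needs `dim i ≤ dim k + 1`, hence `dim k > n`, where the cochain has no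
    -- coordinates.
    rcases lt_or_ge n (dim k) with hk | hk
    · rw [coord_eq_zero _ hk, zero_mul]
    · rw [orbitMatrix_eq_zero (by omega), mul_zero]
  · have h1 := truncation_coe (n + 1) ⟨_, basis_mem h (rep (decode i).2)⟩
    rw [coord_apply, h1]
    change f.hom (differentialLinear n _) = _
    rw [apply_eq_pairing]
    change pairing _ (orbitMap ∘ ops.total (n + 1) (basis (decode i).1 (rep (decode i).2))) = _
    have h2 := orbitHom.total (n + 1) (basis (decode i).1 (rep (decode i).2))
    change _ = orbitMap ∘ _ at h2
    rw [← h2]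
    change pairing _ (orbitOps.total (n + 1) (orbitMap ∘ basis (decode i).1 (rep (decode i).2))) = _
    rw [orbitMap_comp_basis, encode_decode, pairing_total]

/-- A criterion for the cohomology of the crystallographic group in terms of coordinates. -/
theorem nonempty_cohomology_equiv (m : ℕ) {Q : Type} [AddCommGroup Q]
    (φ : (Fin 32 → ℤ) →+ Q)
    (h1 : ∀ q, ∃ F : Fin 32 → ℤ, (∀ i, m + 1 < dim i → F i = 0) ∧
      Matrix.vecMul F (orbitMatrix (m + 2)) = 0 ∧ φ F = q)
    (h2 : ∀ F : Fin 32 → ℤ, (∀ i, m + 1 < dim i → F i = 0) →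
      Matrix.vecMul F (orbitMatrix (m + 2)) = 0 → (φ F = 0 ↔ ∃ G : Fin 32 → ℤ,
        (∀ i, m < dim i → G i = 0) ∧ Matrix.vecMul G (orbitMatrix (m + 1)) = F)) :
    Nonempty (crystalCohomology (m + 1) ≃+ Q) := by
  let K := resolution.complex.linearYonedaObj ℤ trivialRep
  have hK : ∀ (n : ℕ) (f : chains n ⟶ trivialRep), K.d n (n + 1) f = differential n ≫ f := by
    intro n f
    rw [← chainComplex_d]
    rfl
  let ψ : K.X (m + 1) →ₗ[ℤ] Q :=
    { toFun := fun f => φ (coord (m + 1) f)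
      map_add' := fun f g => by
        refine Eq.trans ?_ (map_add φ _ _)
        exact congrArg φ (map_add (coord (m + 1)) f g)
      map_smul' := fun c f =>
        AddMonoidHom.map_int_module_smul (M := K.X (m + 1)) (φ.comp (coord (m + 1))) c f }
  obtain ⟨e⟩ := CochainComplex.nonempty_homology_equiv K m ψ
    (fun q => by
      obtain ⟨F, hF, hF', rfl⟩ := h1 q
      refine ⟨cochain (m + 1) F, ?_, congrArg φ (coord_cochain hF)⟩
      rw [hK]
      refine coord_injective _ ?_
      rw [coord_differential, coord_cochain hF, hF']
      exact (map_zero _).symm)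
    (fun f hf => by
      have hf' := congrArg (coord (m + 2)) ((hK (m + 1) f).symm.trans hf)
      have hf2 := (coord_differential f).symm.trans (hf'.trans (map_zero _))
      refine (h2 _ (fun i hi => coord_eq_zero f hi) hf2).trans ⟨?_, ?_⟩
      · rintro ⟨G, hG, hG'⟩
        refine ⟨cochain m G, ?_⟩
        rw [hK]
        refine coord_injective _ ?_
        rw [coord_differential, coord_cochain hG, hG']
      · rintro ⟨g, rfl⟩
        refine ⟨coord m g, fun i hi => coord_eq_zero g hi, ?_⟩
        exact (coord_differential _).symm.trans (congrArg (coord (m + 1)) (hK m g).symm))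
  exact ⟨((groupCohomologyIso trivialRep (m + 1) resolution).toLinearEquiv.toAddEquiv).trans e⟩

end Site

/-! ### Certificates for cohomology groups -/

/-- A row vector of length `n`, given by the list of its nonzero entries. -/
abbrev SparseRow (n : ℕ) : Type := List (Fin n × ℤ)

namespace SparseRow

/-- The linear combination of the values of `G` with coefficients the entries of `r`. -/
def comb {n : ℕ} (r : SparseRow n) (G : Fin n → ℤ) : ℤ := (r.map fun p => p.2 * G p.1).sum

/-- The entries of a sparse row. -/
def entry {n : ℕ} (r : SparseRow n) (j : Fin n) : ℤ :=
  (r.map fun p => if p.1 = j then p.2 else 0).sum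

theorem sum_entry_mul {n : ℕ} (r : SparseRow n) (G : Fin n → ℤ) :
    ∑ k, r.entry k * G k = r.comb G := by
  induction r with
  | nil => simp [entry, comb]
  | cons p r ih =>
    simp only [entry, comb] at ih
    simp [entry, comb, add_mul, Finset.sum_add_distrib, ih, ite_mul]

end SparseRow

/-- A matrix given by a list of sparse rows. -/
abbrev SparseMatrix (n : ℕ) : Type := List (SparseRow n)

namespace SparseMatrix

/-- A row of a sparse matrix. -/
def row {n : ℕ} (A : SparseMatrix n) (i : ℕ) : SparseRow n := A.getD i []

/-- The matrix with the given sparse rows. -/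
def toMatrix {n : ℕ} (A : SparseMatrix n) (m : ℕ) : Matrix (Fin m) (Fin n) ℤ :=
  fun i j => (A.row i).entry j

theorem toMatrix_mul_apply {n l : ℕ} (A : SparseMatrix n) (m : ℕ) (B : Matrix (Fin n) (Fin l) ℤ)
    (i : Fin m) (j : Fin l) : (A.toMatrix m * B) i j = (A.row i).comb fun k => B k j := by
  rw [Matrix.mul_apply, ← SparseRow.sum_entry_mul]
  rfl

end SparseMatrix

theorem LatticeOps.periodic_eq_of_mod {M : Type*} [AddCommGroup M] (o : LatticeOps M) {p q : ℕ}
    (hp : p ≠ 0) (hq : q ≠ 0) (h : p % 2 = q % 2) : o.periodic p = o.periodic q := by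
  funext x
  simp [periodic, hp, hq, h]

namespace Site

theorem orbitMatrix_row_eq {n n' : ℕ} {i : Fin 32} (h : dim i < n) (h' : dim i < n')
    (hn : n % 2 = n' % 2) (j : Fin 32) : orbitMatrix n i j = orbitMatrix n' i j := by
  have h1 : ∀ x : Cell → ℤ × ℤ, orbitOps.total n x (decode i).1 =
      orbitOps.total n' x (decode i).1 := fun x => by
    rw [dim] at h h'
    simp only [LatticeOps.total]
    rw [orbitOps.periodic_eq_of_mod (q := n' - (decode i).1.dim) (by omega) (by omega) (by omega)]
  simp only [orbitMatrix, h1]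

/-- On the support of `F` the periodic degree is positive for both `n` and `n'`, so only parity
matters. The bound `min m 4` suffices because no cell has dimension above four. -/
theorem vecMul_orbitMatrix_eq {m n n' : ℕ} (h : m < n) (h' : min m 4 < n') (hn : n % 2 = n' % 2)
    {F : Fin 32 → ℤ} (hF : ∀ i, m < dim i → F i = 0) :
    F ᵥ* orbitMatrix n = F ᵥ* orbitMatrix n' := by
  funext j
  simp only [vecMul, dotProduct]
  refine Finset.sum_congr rfl fun i _ => ?_
  rcases lt_or_ge m (dim i) with hi | hi
  · rw [hF i hi, zero_mul, zero_mul]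
  · have := (decode i).1.dim_le
    rw [← dim] at this
    rw [orbitMatrix_row_eq (n' := n') (by omega) (by omega) hn]

/-- A certificate for the cohomology in degree `m + 1`: a basis `U` of cocycles modulo coboundaries
of orders `T` with dual functionals `Φ`, a homotopy `h` and a rational homotopy `h' / N`. -/
theorem nonempty_cohomology_equiv_of_certificate (m : ℕ) {κ : ℕ} (T : Fin κ → ℕ)
    (P Q : Matrix (Fin 32) (Fin 32) ℤ)
    (hP : ∀ G : Fin 32 → ℤ, (∀ i, m < dim i → G i = 0) → G ᵥ* orbitMatrix (m + 1) = G ᵥ* P)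
    (hQ : ∀ F : Fin 32 → ℤ, (∀ i, m + 1 < dim i → F i = 0) →
      F ᵥ* orbitMatrix (m + 2) = F ᵥ* Q)
    (Φ : Matrix (Fin 32) (Fin κ) ℤ) (U : Matrix (Fin κ) (Fin 32) ℤ)
    (h h' : Matrix (Fin 32) (Fin 32) ℤ) (W : Matrix (Fin κ) (Fin 32) ℤ) (N : ℤ) (hN : N ≠ 0)
    (hU : ∀ k i, m + 1 < dim i → U k i = 0)
    (hh : ∀ i j, m < dim j → h i j = 0)
    (hW : ∀ k j, m < dim j → W k j = 0)
    (h1 : U * Q = 0) (h2 : U * Φ = 1)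
    (h3 : ∀ i, dim i ≤ m + 1 → ∀ j, N * (1 - Φ * U - h * P : Matrix (Fin 32) (Fin 32) ℤ) i j = (Q * h') i j)
    (h4 : ∀ i, dim i ≤ m → ∀ l, (T l : ℤ) ∣ (P * Φ) i l)
    (h5 : ∀ k j, T k * U k j = (W * P) k j) :
    Nonempty (crystalCohomology (m + 1) ≃+ ∀ l, ZMod (T l)) := by
  let φ : (Fin 32 → ℤ) →+ ∀ l, ZMod (T l) :=
    AddMonoidHom.mk' (fun F l => (((F ᵥ* Φ) l : ℤ) : ZMod (T l))) fun F G => by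
      funext l
      simp [add_vecMul]
  have hφ : ∀ F l, φ F l = (((F ᵥ* Φ) l : ℤ) : ZMod (T l)) := fun _ _ => rfl
  refine nonempty_cohomology_equiv m φ (fun q => ?_) fun F hF hFQ => ?_
  · choose c hc using fun l => ZMod.intCast_surjective (q l)
    have hs : ∀ i, m + 1 < dim i → (c ᵥ* U) i = 0 := fun i hi => by
      rw [vecMul, dotProduct, Finset.sum_eq_zero fun k _ => by rw [hU k i hi, mul_zero]]
    refine ⟨c ᵥ* U, hs, ?_, ?_⟩
    · rw [hQ _ hs, vecMul_vecMul, h1, vecMul_zero]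
    · funext l
      rw [hφ, vecMul_vecMul, h2, vecMul_one, hc]
  · rw [hQ F hF] at hFQ
    constructor
    · intro hF0
      have hd : ∀ l, (T l : ℤ) ∣ (F ᵥ* Φ) l := fun l =>
        (CharP.intCast_eq_zero_iff (ZMod (T l)) (T l) _).1 (congrFun hF0 l)
      choose c hc using hd
      have hTU : (F ᵥ* Φ) ᵥ* U = c ᵥ* (W * P) := by
        funext j
        change ∑ k, (F ᵥ* Φ) k * U k j = ∑ k, c k * (W * P) k j
        refine Finset.sum_congr rfl fun k _ => ?_
        rw [hc, ← h5]
        ring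
      -- On cocycles the term with `Q` in `h3` vanishes, and `N` can be cancelled because `ℤ` is
      -- torsion-free. This is why the upper homotopy need only be rational.
      have hF1 : F = F ᵥ* (Φ * U) + F ᵥ* (h * P) := by
        have h6 : N • (F ᵥ* (1 - Φ * U - h * P)) = F ᵥ* (Q * h') := by
          funext j
          simp only [Pi.smul_apply, smul_eq_mul, vecMul, dotProduct, Finset.mul_sum]
          refine Finset.sum_congr rfl fun i _ => ?_
          rcases lt_or_ge (m + 1) (dim i) with hi | hi
          · simp [hF i hi]
          · rw [← h3 i hi]; ring
        rw [← vecMul_vecMul, hFQ, zero_vecMul, smul_eq_zero_iff_right hN, vecMul_sub, vecMul_sub,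
          vecMul_one, sub_sub, sub_eq_zero] at h6
        exact h6
      have hG : ∀ i, m < dim i → (c ᵥ* W + F ᵥ* h) i = 0 := fun i hi => by
        rw [Pi.add_apply, vecMul, vecMul, dotProduct, dotProduct,
          Finset.sum_eq_zero fun k _ => by rw [hW k i hi, mul_zero],
          Finset.sum_eq_zero fun k _ => by rw [hh k i hi, mul_zero], add_zero]
      refine ⟨c ᵥ* W + F ᵥ* h, hG, ?_⟩
      rw [hP _ hG, add_vecMul, vecMul_vecMul, vecMul_vecMul, ← hTU, vecMul_vecMul]
      exact hF1.symm
    · rintro ⟨G, hG, rfl⟩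
      funext l
      rw [hφ, hP G hG, vecMul_vecMul, vecMul, dotProduct]
      refine (CharP.intCast_eq_zero_iff (ZMod (T l)) (T l) _).2 (Finset.dvd_sum fun i _ => ?_)
      rcases lt_or_ge m (dim i) with hi | hi
      · simp [hG i hi]
      · exact Dvd.dvd.mul_left (h4 i hi l) _

end Site

/-- Sparse data witnessing that a cohomology group is a product of cyclic groups: the orders of the
factors, dual functionals, cocycles, two homotopies, bounding cochains and a denominator. -/
structure Certificate (κ : ℕ) where
  /-- The orders of the cyclic factors, with zero for an infinite factor. -/
  order : Fin κ → ℕ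
  /-- The functionals dual to the generating cocycles. -/
  functional : SparseMatrix κ
  /-- The generating cocycles. -/
  cocycle : SparseMatrix 32
  /-- The homotopy into the lower degree. -/
  lower : SparseMatrix 32
  /-- The homotopy out of the upper degree, multiplied by the denominator. -/
  upper : SparseMatrix 32
  /-- Cochains that bound the multiples of the cocycles by their orders. -/
  bound : SparseMatrix 32
  /-- The denominator of the upper homotopy. -/
  denom : ℤ

namespace Certificate

variable {κ : ℕ}

/-- The identities that a certificate has to satisfy for the coboundaries given by `P` and `Q`, in
the range of cells cut out by the three dimension bounds. -/
def Valid (c : Certificate κ) (P Q : SparseMatrix 32) (s t u : ℕ) : Prop :=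
  c.denom ≠ 0 ∧
  (∀ (k : Fin κ) (i : Fin 32), s < Site.dim i → (c.cocycle.row k).entry i = 0) ∧
  (∀ i j : Fin 32, t < Site.dim j → (c.lower.row i).entry j = 0) ∧
  (∀ (k : Fin κ) (j : Fin 32), t < Site.dim j → (c.bound.row k).entry j = 0) ∧
  (∀ (k : Fin κ) (j : Fin 32), (c.cocycle.row k).comb (fun i => (Q.row i).entry j) = 0) ∧
  (∀ k l : Fin κ, (c.cocycle.row k).comb (fun i => (c.functional.row i).entry l) =
    if k = l then 1 else 0) ∧
  (∀ i : Fin 32, Site.dim i ≤ s → ∀ j : Fin 32,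
    c.denom * ((if i = j then 1 else 0) -
      (c.functional.row i).comb (fun k => (c.cocycle.row k).entry j) -
      (c.lower.row i).comb (fun k => (P.row k).entry j)) =
    (Q.row i).comb fun k => (c.upper.row k).entry j) ∧
  (∀ i : Fin 32, Site.dim i ≤ u → ∀ l : Fin κ,
    (c.order l : ℤ) ∣ (P.row i).comb fun k => (c.functional.row k).entry l) ∧
  ∀ (k : Fin κ) (j : Fin 32), c.order k * (c.cocycle.row k).entry j =
    (c.bound.row k).comb fun i => (P.row i).entry j

instance (c : Certificate κ) (P Q : SparseMatrix 32) (s t u : ℕ) :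
    Decidable (c.Valid P Q s t u) := by
  unfold Valid
  infer_instance

/-- The bounds `s, t, u` decouple the finite check from `m`: enlarging `u` or shrinking `t` only
strengthens validity, so one certificate can serve infinitely many degrees. -/
theorem Valid.nonempty_cohomology_equiv {c : Certificate κ} {P Q : SparseMatrix 32} {s t u : ℕ}
    (hc : c.Valid P Q s t u) {m p q : ℕ} (hP : Site.orbitMatrix p = P.toMatrix 32)
    (hQ : Site.orbitMatrix q = Q.toMatrix 32) (hs : s = min (m + 1) 4) (ht : t ≤ m)
    (hu : min m 4 ≤ u) (hp : 4 < p) (hq : 4 < q) (hp2 : (m + 1) % 2 = p % 2)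
    (hq2 : (m + 2) % 2 = q % 2) :
    Nonempty (crystalCohomology (m + 1) ≃+ ∀ l, ZMod (c.order l)) := by
  obtain ⟨hN, hU, hh, hW, h1, h2, h3, h4, h5⟩ := hc
  have hd : ∀ i, Site.dim i ≤ 4 := fun i => Cell.dim_le _
  refine Site.nonempty_cohomology_equiv_of_certificate m c.order (P.toMatrix 32) (Q.toMatrix 32)
    (fun G hG => ?_) (fun F hF => ?_) (c.functional.toMatrix 32) (c.cocycle.toMatrix κ)
    (c.lower.toMatrix 32) (c.upper.toMatrix 32) (c.bound.toMatrix κ) c.denom hN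
    (fun k i hi => hU k i (by omega)) (fun i j hj => hh i j (by omega))
    (fun k j hj => hW k j (by omega)) ?_ ?_ (fun i hi j => ?_) (fun i hi l => ?_)
    fun k j => ?_
  · rw [← hP]
    exact Site.vecMul_orbitMatrix_eq (by omega) (by omega) hp2 hG
  · rw [← hQ]
    exact Site.vecMul_orbitMatrix_eq (by omega) (by omega) hq2 hF
  · ext k j
    rw [SparseMatrix.toMatrix_mul_apply]
    exact h1 k j
  · ext k l
    rw [SparseMatrix.toMatrix_mul_apply, Matrix.one_apply]
    exact h2 k l
  · rw [Matrix.sub_apply, Matrix.sub_apply, Matrix.one_apply, SparseMatrix.toMatrix_mul_apply,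
      SparseMatrix.toMatrix_mul_apply, SparseMatrix.toMatrix_mul_apply]
    exact h3 i (by have := hd i; omega) j
  · rw [SparseMatrix.toMatrix_mul_apply]
    exact h4 i (by have := hd i; omega) l
  · rw [SparseMatrix.toMatrix_mul_apply]
    exact h5 k j

end Certificate

/-! ### Explicit coboundary matrices and certificates -/

namespace Site

/-- The rows of the coboundary matrix in odd degrees from five on. -/
def oddRows : SparseMatrix 32 :=
  [[(2, -1), (3, 1), (4, -1), (5, 1), (8, -1), (9, 1), (16, -1), (17, 1)],
   [(2, 1), (3, -1), (4, 1), (5, -1), (8, 1), (9, -1), (16, 1), (17, -1)],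
   [(2, -4), (6, 1), (7, -1), (10, 1), (11, -1), (18, 1), (19, -1)],
   [(3, -4), (6, -1), (7, 1), (10, -1), (11, 1), (18, -1), (19, 1)],
   [(4, -2), (5, 2), (6, -1), (7, 1), (12, 1), (13, -1), (20, 1), (21, -1)],
   [(4, 2), (5, -2), (6, 1), (7, -1), (12, -1), (13, 1), (20, -1), (21, 1)],
   [(6, -1), (7, -1), (14, -1), (15, 1), (22, -1), (23, 1)],
   [(6, -1), (7, -1), (14, 1), (15, -1), (22, 1), (23, -1)],
   [(8, -1), (9, 1), (10, -1), (11, 1), (12, -1), (13, 1), (16, -1), (17, 1), (24, 1),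
    (25, -1)],
   [(8, 1), (9, -1), (10, 1), (11, -1), (12, 1), (13, -1), (16, 1), (17, -1), (24, -1),
    (25, 1)],
   [(10, -1), (14, 1), (15, -1), (19, -1), (26, -1), (27, 1)],
   [(11, -1), (14, -1), (15, 1), (18, -1), (26, 1), (27, -1)],
   [(12, -1), (14, -1), (15, 1), (20, 1), (28, -1), (29, 1)],
   [(13, -1), (14, 1), (15, -1), (21, 1), (28, 1), (29, -1)],
   [(14, -1), (15, 1), (22, -1), (23, 1), (30, 1), (31, -1)],
   [(14, 1), (15, -1), (22, 1), (23, -1), (30, -1), (31, 1)],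
   [(8, -1), (9, 1), (16, -1), (17, 1), (18, -1), (19, 1), (20, -1), (21, 1), (24, -1),
    (25, 1)],
   [(8, 1), (9, -1), (16, 1), (17, -1), (18, 1), (19, -1), (20, 1), (21, -1), (24, 1),
    (25, -1)],
   [(10, 1), (18, -1), (22, 1), (23, -1), (26, 1), (27, -1)],
   [(11, 1), (19, -1), (22, -1), (23, 1), (26, -1), (27, 1)],
   [(13, -1), (20, -1), (22, -1), (23, 1), (28, 1), (29, -1)],
   [(12, -1), (21, -1), (22, 1), (23, -1), (28, -1), (29, 1)],
   [(14, -1), (15, 1), (22, -1), (23, 1), (30, -1), (31, 1)],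
   [(14, 1), (15, -1), (22, 1), (23, -1), (30, 1), (31, -1)],
   [(24, -1), (25, 1), (26, -1), (27, 1), (28, -1), (29, 1)],
   [(24, 1), (25, -1), (26, 1), (27, -1), (28, 1), (29, -1)],
   [(26, -2), (27, -2), (30, 1), (31, -1)], [(26, -2), (27, -2), (30, -1), (31, 1)],
   [(30, -1), (31, 1)], [(30, 1), (31, -1)], [(30, -2)], [(31, -2)]]

/-- The rows of the coboundary matrix in even degrees from six on. -/
def evenRows : SparseMatrix 32 :=
  [[(0, 4), (2, -1), (3, 1), (4, -1), (5, 1), (8, -1), (9, 1), (16, -1), (17, 1)],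
   [(1, 4), (2, 1), (3, -1), (4, 1), (5, -1), (8, 1), (9, -1), (16, 1), (17, -1)],
   [(6, 1), (7, -1), (10, 1), (11, -1), (18, 1), (19, -1)],
   [(6, -1), (7, 1), (10, -1), (11, 1), (18, -1), (19, 1)],
   [(4, 1), (5, 1), (6, -1), (7, 1), (12, 1), (13, -1), (20, 1), (21, -1)],
   [(4, 1), (5, 1), (6, 1), (7, -1), (12, -1), (13, 1), (20, -1), (21, 1)],
   [(6, 2), (7, -2), (14, -1), (15, 1), (22, -1), (23, 1)],
   [(6, -2), (7, 2), (14, 1), (15, -1), (22, 1), (23, -1)],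
   [(8, 1), (10, -1), (11, 1), (12, -1), (13, 1), (17, 1), (24, 1), (25, -1)],
   [(9, 1), (10, 1), (11, -1), (12, 1), (13, -1), (16, 1), (24, -1), (25, 1)],
   [(10, 1), (11, -1), (14, 1), (15, -1), (18, 1), (19, -1), (26, -1), (27, 1)],
   [(10, -1), (11, 1), (14, -1), (15, 1), (18, -1), (19, 1), (26, 1), (27, -1)],
   [(12, 1), (13, -1), (14, -1), (15, 1), (20, 1), (21, -1), (28, -1), (29, 1)],
   [(12, -1), (13, 1), (14, 1), (15, -1), (20, -1), (21, 1), (28, 1), (29, -1)],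
   [(14, 1), (22, -1), (30, 1), (31, -1)], [(15, 1), (23, -1), (30, -1), (31, 1)],
   [(8, -1), (16, 1), (18, -1), (19, 1), (20, -1), (21, 1), (24, -1), (25, 1)],
   [(9, -1), (17, 1), (18, 1), (19, -1), (20, 1), (21, -1), (24, 1), (25, -1)],
   [(10, 1), (11, -1), (18, 1), (19, -1), (22, 1), (23, -1), (26, 1), (27, -1)],
   [(10, -1), (11, 1), (18, -1), (19, 1), (22, -1), (23, 1), (26, -1), (27, 1)],
   [(12, 1), (13, -1), (20, 1), (21, -1), (22, -1), (23, 1), (28, 1), (29, -1)],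
   [(12, -1), (13, 1), (20, -1), (21, 1), (22, 1), (23, -1), (28, -1), (29, 1)],
   [(15, 1), (22, 1), (30, -1), (31, 1)], [(14, 1), (23, 1), (30, 1), (31, -1)],
   [(24, 2), (25, 2), (26, -1), (27, 1), (28, -1), (29, 1)],
   [(24, 2), (25, 2), (26, 1), (27, -1), (28, 1), (29, -1)],
   [(26, 1), (27, -1), (30, 1), (31, -1)], [(26, -1), (27, 1), (30, -1), (31, 1)],
   [(28, 2), (30, -1), (31, 1)], [(29, 2), (30, 1), (31, -1)]]

/-- Five and six are the first degrees of each parity above the top dimension, so no row is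
truncated. -/
theorem orbitMatrix_five : orbitMatrix 5 = oddRows.toMatrix 32 := by
  have h : ∀ p : Fin 32 × Fin 32, orbitMatrix 5 p.1 p.2 = (oddRows.row p.1).entry p.2 := by
    decide +kernel
  exact funext fun i => funext fun j => h (i, j)

/-- Rows 30 and 31 are missing from `evenRows` and default to zero: `rotate` acts by `-1` on the top
cell of the orbit complex, so its norm vanishes. -/
theorem orbitMatrix_six : orbitMatrix 6 = evenRows.toMatrix 32 := by
  have h : ∀ p : Fin 32 × Fin 32, orbitMatrix 6 p.1 p.2 = (evenRows.row p.1).entry p.2 := by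
    decide +kernel
  exact funext fun i => funext fun j => h (i, j)

/-- A certificate for the cohomology in degree one. -/
def certificateOne : Certificate 1 where
  order := ![0]
  functional :=
    [[], [], [(0, 1)], [], [], [], [], [], [(0, -1)]]
  cocycle :=
    [[(2, 1), (3, 1)]]
  lower :=
    [[], [], [], [], [], [], [], [], [(0, -1)]]
  upper :=
    [[(0, 1), (1, 1)], [], [(1, 4), (4, 2), (5, -6), (9, -8), (16, 4), (17, 4)], [],
     [(4, 2), (5, 2)], [], [], [], [(3, 4), (4, -2), (5, 2), (9, 4), (16, -4)], [], [], [],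
     [(4, 2), (5, -2)], [], [], [], [(4, -2), (5, 2), (9, 4)], [(3, 4), (17, 4)], [(3, -4)]]
  bound := []
  denom := 4

theorem valid_certificateOne : certificateOne.Valid oddRows evenRows 1 0 0 := by
  decide +kernel

/-- A certificate for the cohomology in degree two. -/
def certificateTwo : Certificate 3 where
  order := ![0, 4, 2]
  functional :=
    [[], [(1, 1)], [(0, -2), (2, -1)], [], [], [(2, -1)], [], [], [(0, 1)], [(0, -1), (2, 1)],
     [], [], [], [], [], [], [(2, 1)], [], [], [], [(2, 1)], [], [], [], [(0, -1)]]
  cocycle :=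
    [[(8, 1), (10, -1), (11, 1), (12, -1), (13, 1), (17, 1), (25, -2)], [(0, 1), (1, 1)],
     [(6, -1), (7, 1), (12, 1), (13, -1), (20, 1), (21, -1)]]
  lower :=
    [[], [], [(0, -1), (4, 1), (16, -1), (17, -1)], [], [], [(4, 1)], [], [], [],
     [(2, 1), (8, 1), (17, -1)], [], [], [], [], [], [], [(2, 1), (8, 1), (16, 1)], [], [],
     [(2, -1)], [], [], [], [], [(8, 1)]]
  upper :=
    [[], [],
     [(0, -4), (3, -2), (4, 2), (10, 2), (11, -2), (12, 2), (13, -2), (17, -4), (25, 4)], [],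
     [], [(4, 2), (6, 1), (7, 1), (12, -2), (13, -2), (21, 4)], [], [(6, -2), (7, -2)], [],
     [(3, -2), (6, -1), (7, -1), (10, 2), (11, -2), (12, 4), (17, -4), (21, -4), (25, 4)],
     [(3, -2), (6, -1), (7, -1), (10, -2), (11, -2)],
     [(3, 2), (6, 3), (7, -1), (10, 2), (11, -2), (18, 4)], [(21, -4)],
     [(6, -2), (7, 2), (13, -4)], [], [(6, 2), (7, -2)], [], [], [],
     [(6, -2), (7, 2), (10, -4), (18, -4)], [(6, -2), (7, 2), (12, 4), (21, -4)], [], [], [],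
     [], [(3, 2), (6, 1), (7, 1), (10, 2), (11, 2), (18, 4), (25, -4)],
     [(3, 2), (6, 1), (7, 1), (10, 2), (11, 2), (18, 4)]]
  bound :=
    [[], [(0, 1), (1, 1)], [(4, 1), (5, -1)]]
  denom := 4

theorem valid_certificateTwo : certificateTwo.Valid evenRows oddRows 2 1 1 := by
  decide +kernel

/-- A certificate for the cohomology in degree three. -/
def certificateThree : Certificate 3 where
  order := ![0, 4, 2]
  functional :=
    [[], [], [], [(2, -1)], [], [(2, 1)], [(0, -1), (1, -2)], [(0, 1)], [], [],
     [(0, 1), (1, 1)], [(0, -1), (1, 1)], [(0, -1), (1, 1)], [(0, 1), (1, 1)], [], [], [], [],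
     [], [(1, -2)], [], [(1, 2)], [], [(1, -2)], [], [], [(0, -1), (1, 1)], [], [],
     [(0, -1), (1, 1)]]
  cocycle :=
    [[(2, 2), (7, 1), (14, -1), (15, 1), (18, -2), (27, -2)],
     [(2, -2), (7, -1), (10, 1), (18, 1)],
     [(2, -2), (4, -1), (5, 1), (8, -1), (9, 1), (16, -1), (17, 1)]]
  lower :=
    [[], [], [], [(0, 1)], [], [], [(2, 1), (10, -1), (11, -1)], [], [], [], [],
     [(2, -1), (6, -1), (11, 1), (19, 1)],
     [(2, -1), (6, -1), (11, 1), (17, 1), (21, -1), (24, 1)],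
     [(9, -1), (11, 1), (12, -1), (24, 1)], [], [], [], [], [],
     [(2, 1), (6, 1), (10, -1), (11, -2), (19, -1)], [],
     [(2, -1), (6, -1), (10, 1), (11, 1), (12, 1), (21, -1)], [],
     [(2, 1), (6, 1), (10, -1), (11, -1)], [(11, -1), (12, 1), (17, 1), (19, -1), (21, -1)],
     [], [(2, -1), (6, -1), (11, 2), (19, 1)], [], [],
     [(2, -1), (6, -1), (11, 1), (12, 1), (17, 1), (21, -1), (24, 1)]]
  upper :=
    [[], [(0, 1), (1, 1)],
     [(0, -4), (2, -4), (4, -4), (9, 8), (16, -12), (17, 4), (18, -4), (20, -4), (25, 4)], [],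
     [(2, 4), (4, 4), (8, 2), (9, -2), (16, 2), (17, -2)], [],
     [(2, 4), (14, -8), (15, 4), (18, -4), (22, -4), (27, -4), (28, -4)], [], [],
     [(8, 2), (9, 2), (16, -2), (17, -2)], [],
     [(14, -8), (15, 4), (18, -4), (22, -4), (27, -4), (28, -4)],
     [(8, -2), (9, 2), (14, -8), (15, 4), (16, -2), (17, 2), (18, -4), (22, -4), (27, -4),
      (28, -4)],
     [], [], [(14, 4), (22, 4)],
     [(8, 1), (9, -1), (16, 5), (17, -1), (18, 2), (20, 2), (25, -2)],
     [(8, 1), (9, 3), (16, -3), (17, 3), (18, -2), (20, -2), (25, 2)], [], [], [], [],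
     [(14, -4), (28, -4)], [(14, 4), (15, -4), (22, 4), (28, 4)], [],
     [(8, -1), (9, 1), (16, -1), (17, 1), (18, -2), (20, -2), (25, 2)], [],
     [(27, 4), (28, -4)], [],
     [(8, -2), (9, 2), (16, -2), (17, 2), (18, -4), (20, -4), (27, -4), (28, 4)], [(28, -4)]]
  bound :=
    [[], [(2, 2), (6, 1), (7, 1), (10, -2), (11, -2)], [(2, 1), (4, 1), (9, -1), (17, -1)]]
  denom := 4

theorem valid_certificateThree : certificateThree.Valid oddRows evenRows 3 2 2 := by
  decide +kernel

/-- A certificate for the cohomology in even degrees from four on. -/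
def certificateEven : Certificate 2 where
  order := ![4, 4]
  functional :=
    [[], [(0, 1)], [], [(1, -4)], [], [(1, 2)], [], [], [(1, -3)], [(1, 1)], [], [], [],
     [(1, 2)], [], [], [(1, 2)], [], [], [], [], [], [], [], [(1, 1)], [], [], [], [(1, 2)]]
  cocycle :=
    [[(0, 1), (1, 1)], [(24, 1), (25, 1)]]
  lower :=
    [[], [], [],
     [(0, 1), (2, -1), (4, -1), (8, 1), (9, 1), (17, 2), (18, 1), (20, 1), (24, 1)], [],
     [(2, 1), (4, 1), (18, -1), (20, -1), (24, -1)],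
     [(2, 1), (10, -1), (15, -1), (23, 1), (26, -1), (29, -1)], [],
     [(8, 1), (18, 1), (20, 1), (24, 1)], [(17, -1)], [],
     [(10, -1), (15, -1), (23, 1), (26, -1), (29, -1)], [],
     [(10, 1), (15, 1), (18, -1), (20, -1), (23, -1), (24, -1), (26, 1), (29, 1)],
     [(23, 1), (29, -1)], [(15, 1), (29, 1)], [(9, 1), (17, 1), (18, -1), (20, -1), (24, -1)],
     [], [], [], [], [], [(10, -1), (15, -1), (18, 1), (23, 1), (26, -2)], [], [], [], [],
     [(26, -1), (29, 1)], [(24, -1), (26, -1), (29, 1)], [], [], [(29, -1)]]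
  upper :=
    [[], [], [],
     [(0, 2), (2, -1), (4, -1), (17, 2), (18, 1), (19, -1), (20, 1), (21, -1), (25, -2)], [],
     [(2, 1), (4, 1), (10, 2), (18, 1), (19, 1), (20, -1), (21, -1), (26, -1), (29, 1)],
     [(2, 1), (7, -1), (10, 2), (18, 1), (19, 1), (23, 1), (26, -1)],
     [(2, -1), (7, -1), (10, -2), (18, -1), (19, -1), (23, 1), (26, 1), (29, -2)], [],
     [(10, -2), (17, -2), (18, -2), (21, 2), (25, 2), (26, 1), (29, -1)],
     [(10, -2), (26, 1), (29, -1)], [(19, 2), (23, 2), (26, -1), (29, -1)], [],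
     [(12, -2), (20, -2), (23, -2), (29, 2)], [], [], [], [],
     [(10, -2), (18, -2), (23, 2), (29, -2)], [], [], [(12, 2), (21, -2), (23, 2), (29, -2)],
     [], [(23, -2), (29, 2)], [], [(12, -2), (25, -2), (26, -1), (29, 1)], [(26, -1), (29, 1)],
     [], [], [(12, 2)], [(30, -1)], [(29, -2), (30, -1)]]
  bound :=
    [[(0, 1), (1, 1)], [(24, 1), (25, 1)]]
  denom := 2

/-- In degree four the cochains one degree below live in dimension at most three, whence `t = 3`; in
higher degrees they can reach dimension four, whence `u = 4`. -/
theorem valid_certificateEven : certificateEven.Valid evenRows oddRows 4 3 4 := by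
  decide +kernel

/-- A certificate for the cohomology in odd degrees from five on. -/
def certificateOdd : Certificate 4 where
  order := ![2, 2, 2, 2]
  functional :=
    [[], [], [(3, 1)], [], [], [(3, 1)], [(1, 1)], [(1, -1)], [], [], [(0, 1)], [(0, -1)],
     [(0, -1)], [(0, 1)], [], [], [], [], [], [], [], [], [], [], [], [], [], [(0, 1)], [],
     [(0, -1)], [(2, 1)], [(2, 1)]]
  cocycle :=
    [[(26, 1), (27, 1)], [(3, 2), (6, 1), (18, 2), (22, -1), (23, 1), (26, -2)], [(31, 1)],
     [(3, 2), (4, -1), (5, 1), (18, 2), (20, 2), (24, 1), (25, -1)]]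
  lower :=
    [[], [], [(0, -1), (10, 1), (13, -1), (17, -1), (18, 1), (20, 1)], [], [], [], [],
     [(6, -1), (23, -1), (28, -1)], [], [], [(18, 1)],
     [(10, -1), (18, -1), (19, 1), (23, 1), (28, 1)],
     [(9, 1), (13, -1), (17, -1), (18, -1), (19, 1), (23, 1), (25, 1), (28, 1)],
     [(20, -1), (25, 1)], [], [(23, -1), (28, -1)],
     [(10, -1), (13, 1), (17, 1), (18, -1), (20, -1)], [], [],
     [(10, -1), (18, -1), (23, 1), (28, 1)], [], [(13, 1), (20, -1), (23, -1), (28, -1)], [],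
     [], [], [], [], [], [], [(25, -1)], [(28, -1)]]
  upper :=
    [[(0, 1), (1, 1)], [],
     [(1, 4), (3, -4), (4, 4), (8, -4), (9, -4), (17, -8), (18, 4), (20, 4), (25, -4)], [], [],
     [(3, -4), (4, 4), (18, -4), (20, -4), (24, -2), (25, 2)],
     [(3, -4), (14, 4), (18, -4), (23, -4), (26, 4), (28, 4)], [], [(8, 4), (24, 1), (25, 1)],
     [(17, -4), (18, 4), (20, 4), (24, 1), (25, -3)], [], [], [], [], [(14, 4), (28, 4)],
     [(22, 4), (28, -4)], [(9, 4), (17, 4), (18, -4), (20, -4), (24, -2), (25, 2)], [],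
     [(14, -4), (18, 4), (23, 4), (26, -4), (28, -4)], [],
     [(14, 4), (20, 4), (23, -4), (24, 2), (25, -2), (26, 4), (28, 4)], [], [],
     [(14, -4), (23, 4)], [], [(24, 1), (25, 1)], [], [(26, -4), (28, -4)], [],
     [(24, 2), (25, -2), (26, 4), (28, 4)], [(28, -4)]]
  bound :=
    [[(26, -1), (28, -1)],
     [(3, -1), (6, -1), (10, -2), (18, -3), (19, 1), (23, 1), (26, 1), (28, 2)], [(31, -1)],
     [(3, -1), (4, 1), (9, -1), (10, -2), (13, 2), (17, 1), (18, -2), (20, -2)]]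
  denom := 4

theorem valid_certificateOdd : certificateOdd.Valid oddRows evenRows 4 4 4 := by
  decide +kernel

end Site

/-! ### Assembly of the cohomology groups -/

/-- A product of three groups as a product over a finite type. -/
def piFinThreeAddEquiv (A : Fin 3 → Type) [∀ i, AddCommGroup (A i)] :
    (∀ i, A i) ≃+ A 0 × A 1 × A 2 where
  toFun f := (f 0, f 1, f 2)
  invFun p := Fin.cons p.1 (Fin.cons p.2.1 (Fin.cons p.2.2 finZeroElim))
  left_inv f := by
    funext i
    fin_cases i <;> rfl
  right_inv _ := rfl
  map_add' _ _ := rfl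

/-- A product of four groups as a product over a finite type. -/
def piFinFourAddEquiv (A : Fin 4 → Type) [∀ i, AddCommGroup (A i)] :
    (∀ i, A i) ≃+ A 0 × A 1 × A 2 × A 3 where
  toFun f := (f 0, f 1, f 2, f 3)
  invFun p := Fin.cons p.1 (Fin.cons p.2.1 (Fin.cons p.2.2.1 (Fin.cons p.2.2.2 finZeroElim)))
  left_inv f := by
    funext i
    fin_cases i <;> rfl
  right_inv _ := rfl
  map_add' _ _ := rfl

/-- A product of two groups as a product over a finite type. -/
def piFinTwoAddEquiv (A : Fin 2 → Type) [∀ i, AddCommGroup (A i)] :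
    (∀ i, A i) ≃+ A 0 × A 1 where
  toFun f := (f 0, f 1)
  invFun p := Fin.cons p.1 (Fin.cons p.2 finZeroElim)
  left_inv f := by
    funext i
    fin_cases i <;> rfl
  right_inv _ := rfl
  map_add' _ _ := rfl

theorem proposition3p1 :
    Nonempty (crystalCohomology 1 ≃+ ℤ) ∧
    Nonempty (crystalCohomology 2 ≃+ ℤ × ZMod 4 × ZMod 2) ∧
    Nonempty (crystalCohomology 3 ≃+ ℤ × ZMod 4 × ZMod 2) ∧
    (∀ k : ℕ, 2 ≤ k → Nonempty (crystalCohomology (2 * k) ≃+ ZMod 4 × ZMod 4)) ∧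
    (∀ k : ℕ, 2 ≤ k →
      Nonempty (crystalCohomology (2 * k + 1) ≃+ ZMod 2 × ZMod 2 × ZMod 2 × ZMod 2)) := by
  refine ⟨?_, ?_, ?_, fun k hk => ?_, fun k hk => ?_⟩
  · obtain ⟨e⟩ := Site.valid_certificateOne.nonempty_cohomology_equiv (m := 0)
      Site.orbitMatrix_five Site.orbitMatrix_six (by decide) (by decide) (by decide) (by decide)
      (by decide) (by decide) (by decide)
    -- The order zero encodes an infinite factor, as `ZMod 0` is `ℤ` by definition.
    exact ⟨e.trans (AddEquiv.piUnique fun l => ZMod (Site.certificateOne.order l))⟩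
  · obtain ⟨e⟩ := Site.valid_certificateTwo.nonempty_cohomology_equiv (m := 1)
      Site.orbitMatrix_six Site.orbitMatrix_five (by decide) (by decide) (by decide) (by decide)
      (by decide) (by decide) (by decide)
    exact ⟨e.trans (piFinThreeAddEquiv fun l => ZMod (Site.certificateTwo.order l))⟩
  · obtain ⟨e⟩ := Site.valid_certificateThree.nonempty_cohomology_equiv (m := 2)
      Site.orbitMatrix_five Site.orbitMatrix_six (by decide) (by decide) (by decide) (by decide)
      (by decide) (by decide) (by decide)
    exact ⟨e.trans (piFinThreeAddEquiv fun l => ZMod (Site.certificateThree.order l))⟩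
  · obtain ⟨m, hm⟩ : ∃ m, 2 * k = m + 1 := ⟨2 * k - 1, by omega⟩
    obtain ⟨e⟩ := Site.valid_certificateEven.nonempty_cohomology_equiv (m := m)
      Site.orbitMatrix_six Site.orbitMatrix_five (by omega) (by omega) (by omega) (by decide)
      (by decide) (by omega) (by omega)
    rw [hm]
    exact ⟨e.trans (piFinTwoAddEquiv fun l => ZMod (Site.certificateEven.order l))⟩
  · obtain ⟨e⟩ := Site.valid_certificateOdd.nonempty_cohomology_equiv (m := 2 * k)
      Site.orbitMatrix_five Site.orbitMatrix_six (by omega) (by omega) (by omega) (by decide)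
      (by decide) (by omega) (by omega)
    exact ⟨e.trans (piFinFourAddEquiv fun l => ZMod (Site.certificateOdd.order l))⟩
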